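/- Let $m,n\ge 1$ be integers and let $p,q>0$ be real. Let $\mathcal S$ be the set of all real tuples $(\{\phi_j\}_{j=1}^m,\{\psi_j\}_{j=1}^m,\{\theta_k\}_{k=1}^{2mn})$ such that $\phi_1=0$ and, for $j=1,\dots,m$ and with $\phi_{m+1}=2\pi$, $$\phi_j<\theta_{2(j-1)n+1}<\cdots<\theta_{(2j-1)n}<\psi_j<\theta_{(2j-1)n+1}<\cdots<\theta_{2jn}<\phi_{j+1}.$$ On $\mathcal S$ define $$\begin{aligned}\tilde H={}&p\sum_{j=1}^m\sum_{k=1}^{2mn}\log|e^{i\phi_j}-e^{i\theta_k}|+q\sum_{j=1}^m\sum_{k=1}^{2mn}\log|e^{i\psi_j}-e^{i\theta_k}|+\sum_{1\le k<j\le 2mn}\log|e^{i\theta_j}-e^{i\theta_k}|\\&+p^2\sum_{1\le k<j\le m}\log|e^{i\phi_j}-e^{i\phi_k}|+q^2\sum_{1\le k<j\le m}\log|e^{i\psi_j}-e^{i\psi_k}|+pq\sum_{1\le j,k\le m}\log|e^{i\phi_j}-e^{i\psi_k}|.\end{aligned}$$ Then $\mathcal S$ is convex, and $\tilde H$ attains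 its maximum on $\mathcal S$ at exactly one point of $\mathcal S$. Moreover, a point of $\mathcal S$ is a maximizer of $\tilde H$ on $\mathcal S$ if and only if $\{e^{i\phi_j}\}_{j=1}^m$ is the set of $m$-th roots of $1$, $\{e^{i\psi_j}\}_{j=1}^m$ is the set of $m$-th roots of $-1$, and $\{e^{i\theta_k}\}_{k=1}^{2mn}$ is the set of complex zeros of the polynomial $$z^{mn}P_n^{(p-1/2,\,q-1/2)}\!\left(\frac{z^m+z^{-m}}{2}\right),$$ where $P_n^{(\alpha,\beta)}$ denotes the Jacobi polynomial of degree $n$. -/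

import Mathlib

open Polynomial

noncomputable section

/-- The Jacobi polynomial `P_n^{(α,β)}`, through the classical formula
`∑_ν (n+α+β+1)⋯(n+α+β+ν) (α+ν+1)⋯(α+n) / (ν! (n-ν)!) ((x-1)/2)^ν`,
which is polynomial in `α`, `β` and so needs no restriction on the parameters. -/
def jacobiPoly (n : ℕ) (α β : ℝ) : ℝ[X] :=
  ∑ ν ∈ Finset.range (n + 1),
    C ((ascPochhammer ℝ ν).eval (n + α + β + 1) * (ascPochhammer ℝ (n - ν)).eval (α + ν + 1)
        / ((ν.factorial : ℝ) * ((n - ν).factorial : ℝ)))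
      * (C (1 / 2 : ℝ) * (X - 1)) ^ ν

/-- The polynomial `z^{mn} P((z^m + z^{-m})/2)`, for a real polynomial `P = ∑_{k ≤ n} a_k x^k`,
with denominators cleared:
`z^{mn} ((z^m + z^{-m})/2)^k = z^{m(n-k)} ((z^{2m} + 1)/2)^k`. -/
def circlePoly (m n : ℕ) (P : ℝ[X]) : ℂ[X] :=
  ∑ k ∈ Finset.range (n + 1),
    C (P.coeff k : ℂ) * X ^ (m * (n - k)) * (C (1 / 2 : ℂ) * (X ^ (2 * m) + 1)) ^ k

theorem circlePoly_eval (m n : ℕ) (P : ℝ[X]) (hP : P.natDegree ≤ n) (z : ℂ) (hz : z ≠ 0) :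
    (circlePoly m n P).eval z = z ^ (m * n) * aeval (z ^ m / 2 + 1 / (2 * z ^ m)) P := by
  rw [aeval_eq_sum_range' (Nat.lt_succ_of_le hP), circlePoly, eval_finsetSum, Finset.mul_sum]
  refine Finset.sum_congr rfl fun k hk => ?_
  have hk' : k ≤ n := Nat.lt_succ_iff.mp (Finset.mem_range.mp hk)
  have hw : z ^ m ≠ 0 := pow_ne_zero _ hz
  have h2 : (1 / 2 : ℂ) * (z ^ (2 * m) + 1) = z ^ m * (z ^ m / 2 + 1 / (2 * z ^ m)) := by
    rw [two_mul, pow_add]; field_simp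
  have h3 : z ^ (m * n) = z ^ (m * (n - k)) * (z ^ m) ^ k := by
    rw [← pow_mul, ← pow_add, ← Nat.mul_add, Nat.sub_add_cancel hk']
  simp only [eval_mul, eval_pow, eval_add, eval_C, eval_X, eval_one]
  rw [h2, h3, mul_pow, Complex.real_smul]
  ring

theorem jacobiPoly_natDegree_le (n : ℕ) (α β : ℝ) : (jacobiPoly n α β).natDegree ≤ n := by
  refine natDegree_sum_le_of_forall_le _ _ fun ν hν => ?_
  refine (natDegree_C_mul_le _ _).trans (natDegree_pow_le.trans ?_)
  have h : (C (1 / 2 : ℝ) * (X - 1)).natDegree ≤ 1 :=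
    (natDegree_C_mul_le _ _).trans (natDegree_X_sub_C_le 1)
  have := Finset.mem_range.mp hν
  calc ν * _ ≤ ν * 1 := Nat.mul_le_mul_left _ h
    _ ≤ n := by omega

/-- The point `e^{it}` of the unit circle. -/
def circPt (t : ℝ) : ℂ := Complex.exp (t * Complex.I)

/-- Triples `(φ, ψ, θ)` of angles: `m` of charge `p`, `m` of charge `q` and `2mn` of charge `1`.
Indices start at `0`. -/
abbrev Config (m n : ℕ) : Type :=
  (Fin m → ℝ) × (Fin m → ℝ) × (Fin (2 * m * n) → ℝ)

/-- The angle that follows `φ j`, with the convention that `2π` follows the last one. -/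
def nextAngle {m : ℕ} (φ : Fin m → ℝ) (j : Fin m) : ℝ :=
  if h : (j : ℕ) + 1 < m then φ ⟨j + 1, h⟩ else 2 * Real.pi

/-- The configuration space: the first angle `φ` is `0`, the `θ`'s increase, the `j`-th block of
`2n` of them is split so that `n` lie between `φ j` and `ψ j`, and the next `n` lie between `ψ j`
and the angle following `φ j`. -/
def configSpace (m n : ℕ) : Set (Config m n) :=
  {x | (∀ j : Fin m, (j : ℕ) = 0 → x.1 j = 0) ∧
    StrictMono x.2.2 ∧
    (∀ (j : Fin m) (k : Fin (2 * m * n)), 2 * (j : ℕ) * n ≤ k → (k : ℕ) < (2 * j + 1) * n →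
      x.1 j < x.2.2 k ∧ x.2.2 k < x.2.1 j) ∧
    (∀ (j : Fin m) (k : Fin (2 * m * n)), (2 * (j : ℕ) + 1) * n ≤ k → (k : ℕ) < (2 * j + 2) * n →
      x.2.1 j < x.2.2 k ∧ x.2.2 k < nextAngle x.1 j)}

/-- The Hamiltonian of a configuration, with charges `p`, `q` and `1`. -/
def hamiltonian (m n : ℕ) (p q : ℝ) (x : Config m n) : ℝ :=
  p * ∑ j, ∑ k, Real.log ‖circPt (x.1 j) - circPt (x.2.2 k)‖
  + q * ∑ j, ∑ k, Real.log ‖circPt (x.2.1 j) - circPt (x.2.2 k)‖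
  + ∑ j, ∑ k ∈ Finset.Iio j, Real.log ‖circPt (x.2.2 j) - circPt (x.2.2 k)‖
  + p ^ 2 * ∑ j, ∑ k ∈ Finset.Iio j, Real.log ‖circPt (x.1 j) - circPt (x.1 k)‖
  + q ^ 2 * ∑ j, ∑ k ∈ Finset.Iio j, Real.log ‖circPt (x.2.1 j) - circPt (x.2.1 k)‖
  + p * q * ∑ j, ∑ k, Real.log ‖circPt (x.1 j) - circPt (x.2.1 k)‖

end

/-! On the configuration space the cyclic order of all angles is fixed, so each ordered difference
stays in `(0, 2π)`, where `log (2 sin (·/2))` is strictly concave. The energy is therefore concave,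
and since one angle is pinned at `0`, any point where all forces vanish is the unique strict
maximizer (`pairEnergy_lt_of_critical`). Existence needs no compactness: a critical point is
exhibited.

The force between two points of the circle is the cotangent of half the angle difference, which
equals `i (z + w) / (z - w)`. Sums of such terms over the roots of a polynomial `R` are read off
from `R'/R`, or from `R''/R'` at a root. With `R` equal to `z^m - 1`, `z^m + 1` and `circlePoly`,
balance at the charges `1` is the Jacobi differential equation in the variable `(z^m + z^{-m})/2`;
balance at the charges `p`, `q` follows from symmetry (`IsJacobiConfig.critical`).

The candidate lies in the configuration space because the Jacobi polynomial has `n` distinct zeros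
in `(-1, 1)` (`jacobiPoly_exists_roots`); their arccosines, reflected and repeated `m` times, are
the angles `θ`. Uniqueness then transfers the description to every maximizer. -/

/-! ### Jacobi polynomials: differential relations and zeros. -/

theorem ascPochhammer_succ_eval_left (n : ℕ) (x : ℝ) :
    (ascPochhammer ℝ (n + 1)).eval x = x * (ascPochhammer ℝ n).eval (x + 1) := by
  simp [ascPochhammer_succ_left, eval_comp]

theorem jacobiPoly_derivative (n : ℕ) (α β : ℝ) :
    derivative (jacobiPoly (n + 1) α β) =
      C ((n + α + β + 2) / 2) * jacobiPoly n (α + 1) (β + 1) := by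
  unfold jacobiPoly
  rw [derivative_sum, Finset.sum_range_succ', Finset.mul_sum]
  simp only [pow_zero, mul_one, derivative_C, add_zero]
  refine Finset.sum_congr rfl fun ν hν => ?_
  have hν' : ν ≤ n := Nat.lt_succ_iff.mp (Finset.mem_range.mp hν)
  rw [derivative_C_mul, derivative_pow, derivative_C_mul, derivative_sub, derivative_X,
    derivative_one, sub_zero, mul_one, Nat.add_sub_cancel, Nat.add_sub_add_right]
  rw [show ∀ a b c : ℝ, ∀ y : ℝ[X], C a * (C b * y * C c) = C (a * b * c) * y from by
    intros; simp only [C_mul]; ring, ← mul_assoc, ← C_mul]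
  congr 2
  rw [ascPochhammer_succ_eval_left, Nat.factorial_succ]
  have h1 : (ν : ℝ) + 1 ≠ 0 := by positivity
  have h2 : (ν.factorial : ℝ) ≠ 0 := by positivity
  have h3 : ((n - ν).factorial : ℝ) ≠ 0 := by positivity
  push_cast
  rw [show (n : ℝ) + 1 + α + β + 1 + 1 = n + (α + 1) + (β + 1) + 1 by ring,
    show α + (ν + 1) + 1 = α + 1 + ν + 1 by ring]
  field_simp
  ring

/-- This is `d/dx [(1-x)^(α+1) (1+x)^(β+1) P_n^{(α+1,β+1)}] = -2(n+1) (1-x)^α (1+x)^β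
P_{n+1}^{(α,β)}` with the weight divided out. It yields both the differential equation and the
induction on zeros. -/
theorem jacobiPoly_raise (n : ℕ) (α β : ℝ) :
    (C (β - α) - C (α + β + 2) * X) * jacobiPoly n (α + 1) (β + 1)
      + (1 - X ^ 2) * derivative (jacobiPoly n (α + 1) (β + 1)) =
      C (-2 * ((n : ℝ) + 1)) * jacobiPoly (n + 1) α β := by
  set Y : ℝ[X] := C (1 / 2 : ℝ) * (X - 1) with hY
  have hX : (X : ℝ[X]) = 1 + 2 * Y := by
    rw [hY, ← mul_assoc, show (2 : ℝ[X]) = C 2 from rfl, ← C_mul]; norm_num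
  have hY' : derivative Y = C (1 / 2) := by simp [hY]
  set b : ℕ → ℝ := fun ν => (ascPochhammer ℝ ν).eval (n + (α + 1) + (β + 1) + 1)
    * (ascPochhammer ℝ (n - ν)).eval (α + 1 + ν + 1) / ((ν.factorial : ℝ) * ((n - ν).factorial : ℝ))
    with hb
  set a : ℕ → ℝ := fun ν => (ascPochhammer ℝ ν).eval (((n + 1 : ℕ) : ℝ) + α + β + 1)
    * (ascPochhammer ℝ (n + 1 - ν)).eval (α + ν + 1)
      / ((ν.factorial : ℝ) * ((n + 1 - ν).factorial : ℝ)) with ha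
  have hJb : jacobiPoly n (α + 1) (β + 1) = ∑ ν ∈ Finset.range (n + 1), C (b ν) * Y ^ ν := rfl
  have hJa : jacobiPoly (n + 1) α β = ∑ ν ∈ Finset.range (n + 2), C (a ν) * Y ^ ν := rfl
  -- The identity compared at `Y^0`, at `Y^(n+1)`, and at the powers in between.
  have h0 : ((n : ℝ) + 1) * a 0 = (α + 1) * b 0 := by
    simp only [ha, hb, Nat.sub_zero, ascPochhammer_zero, eval_one, Nat.factorial_zero,
      ascPochhammer_succ_eval_left, Nat.factorial_succ]
    push_cast
    have h2 : (n.factorial : ℝ) ≠ 0 := by positivity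
    have h1 : (n : ℝ) + 1 ≠ 0 := by positivity
    simp only [add_zero]
    field_simp
  have hlast : ((n : ℝ) + 1) * a (n + 1) = (α + β + 2 + n) * b n := by
    simp only [ha, hb, Nat.sub_self, ascPochhammer_zero, eval_one, Nat.factorial_zero,
      ascPochhammer_succ_eval_left, Nat.factorial_succ]
    push_cast
    have h2 : (n.factorial : ℝ) ≠ 0 := by positivity
    have h1 : (n : ℝ) + 1 ≠ 0 := by positivity
    rw [show (n : ℝ) + 1 + α + β + 1 + 1 = n + (α + 1) + (β + 1) + 1 by ring]
    field_simp
    ring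
  have hmid : ∀ ν, ν < n → ((n : ℝ) + 1) * a (ν + 1) =
      (α + 1 + (ν + 1)) * b (ν + 1) + (α + β + 2 + ν) * b ν := by
    intro ν hν
    obtain ⟨k, rfl⟩ : ∃ k, n = ν + 1 + k := ⟨n - (ν + 1), by omega⟩
    simp only [ha, hb]
    rw [show ν + 1 + k + 1 - (ν + 1) = k + 1 by omega, show ν + 1 + k - (ν + 1) = k by omega,
      show ν + 1 + k - ν = k + 1 by omega, ascPochhammer_succ_eval_left ν,
      ascPochhammer_succ_eval ν, Nat.factorial_succ ν, Nat.factorial_succ k]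
    push_cast
    have h1 : (ν : ℝ) + 1 ≠ 0 := by positivity
    have h2 : (ν.factorial : ℝ) ≠ 0 := by positivity
    have h3 : (k.factorial : ℝ) ≠ 0 := by positivity
    have h4 : (k : ℝ) + 1 ≠ 0 := by positivity
    rw [show (ν : ℝ) + 1 + k + 1 + α + β + 1 + 1 = ν + 1 + k + (α + 1) + (β + 1) + 1 by ring,
      show α + (ν + 1) + 1 = α + 1 + ν + 1 by ring,
      ascPochhammer_succ_eval_left k (α + 1 + ν + 1),
      show α + 1 + ((ν : ℝ) + 1) + 1 = α + 1 + ν + 1 + 1 by ring]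
    field_simp
    ring
  -- Since `Y' = 1/2`, the operator `2Y d/dx` multiplies `Y^ν` by `ν`; it appears because `1 - X^2 =
  -- -(2 + 2Y)(2Y)`.
  have hderiv : derivative (jacobiPoly n (α + 1) (β + 1)) * (2 * Y) =
      ∑ ν ∈ Finset.range (n + 1), C (b ν) * C (ν : ℝ) * Y ^ ν := by
    rw [hJb, derivative_sum, Finset.sum_mul]
    refine Finset.sum_congr rfl fun ν _ => ?_
    rw [derivative_C_mul, derivative_pow, hY']
    rcases ν with _ | ν
    · simp
    · have : (C (1 / 2 : ℝ)) * 2 = (1 : ℝ[X]) := by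
        rw [show (2 : ℝ[X]) = C 2 from rfl, ← C_mul]; norm_num
      rw [Nat.add_sub_cancel]
      linear_combination (C (b (ν + 1)) * C ((ν + 1 : ℕ) : ℝ) * Y ^ (ν + 1)) * this
  have hsum : (C (β - α) - C (α + β + 2) * X) * jacobiPoly n (α + 1) (β + 1)
      + (1 - X ^ 2) * derivative (jacobiPoly n (α + 1) (β + 1)) =
      C (-2) * (∑ ν ∈ Finset.range (n + 1), C ((α + 1 + ν) * b ν) * Y ^ ν
        + ∑ ν ∈ Finset.range (n + 1), C ((α + β + 2 + ν) * b ν) * Y ^ (ν + 1)) := by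
    have e1 : (1 - X ^ 2 : ℝ[X]) * derivative (jacobiPoly n (α + 1) (β + 1)) =
        -(2 + 2 * Y) * ∑ ν ∈ Finset.range (n + 1), C (b ν) * C (ν : ℝ) * Y ^ ν := by
      rw [← hderiv, hX]; ring
    rw [e1, hJb, hX, Finset.mul_sum, Finset.mul_sum, ← Finset.sum_add_distrib,
      ← Finset.sum_add_distrib, Finset.mul_sum]
    refine Finset.sum_congr rfl fun ν _ => ?_
    simp only [C_mul, C_add, C_sub, C_neg, C_1, show (C 2 : ℝ[X]) = 2 from rfl]
    ring
  rw [hsum, C_mul, mul_assoc, hJa, Finset.mul_sum _ _ (C ((n : ℝ) + 1))]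
  congr 1
  rw [Finset.sum_range_succ' _ n, Finset.sum_range_succ _ n, Finset.sum_range_succ' _ (n + 1),
    Finset.sum_range_succ _ n]
  simp only [← mul_assoc, ← C_mul]
  have hsplit : ∑ ν ∈ Finset.range n, C (((n : ℝ) + 1) * a (ν + 1)) * Y ^ (ν + 1) =
      ∑ ν ∈ Finset.range n, C ((α + 1 + (ν + 1)) * b (ν + 1)) * Y ^ (ν + 1)
        + ∑ ν ∈ Finset.range n, C ((α + β + 2 + ν) * b ν) * Y ^ (ν + 1) := by
    rw [← Finset.sum_add_distrib]
    refine Finset.sum_congr rfl fun ν hν => ?_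
    rw [hmid ν (Finset.mem_range.mp hν), C_add, add_mul]
  rw [h0, hlast, hsplit]
  push_cast
  simp only [add_zero]
  ring

/-- Differentiation passes from `(n, α, β)` to `(n-1, α+1, β+1)` and `jacobiPoly_raise` passes back;
the composite is the equation. -/
theorem jacobiPoly_ode (n : ℕ) (hn : 1 ≤ n) (α β : ℝ) :
    (1 - X ^ 2) * derivative (derivative (jacobiPoly n α β))
      + (C (β - α) - C (α + β + 2) * X) * derivative (jacobiPoly n α β)
      + C ((n : ℝ) * (n + α + β + 1)) * jacobiPoly n α β = 0 := by
  obtain ⟨n, rfl⟩ : ∃ k, n = k + 1 := ⟨n - 1, by omega⟩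
  have h := jacobiPoly_raise n α β
  rw [jacobiPoly_derivative, derivative_C_mul]
  have h2 : C ((((n + 1 : ℕ) : ℝ)) * ((n + 1 : ℕ) + α + β + 1)) =
      - (C ((n + α + β + 2) / 2) * C (-2 * ((n : ℝ) + 1))) := by
    rw [← C_mul, ← C_neg]; congr 1; push_cast; ring
  rw [h2]
  linear_combination C ((n + α + β + 2) / 2) * h

theorem jacobiPoly_eval_one_pos (n : ℕ) (α β : ℝ) (hα : -1 < α) :
    0 < (jacobiPoly n α β).eval 1 := by
  rw [jacobiPoly, eval_finsetSum, Finset.sum_range_succ']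
  simp only [eval_mul, eval_C, eval_pow, eval_sub, eval_X, eval_one, sub_self, mul_zero,
    pow_zero, mul_one, ne_eq, Nat.add_eq_zero_iff, one_ne_zero, and_false, not_false_eq_true,
    zero_pow, Finset.sum_const_zero, zero_add]
  refine div_pos (mul_pos (by simp) (ascPochhammer_pos _ _ (by push_cast; linarith)))
    (by positivity)

/-- Rolle's theorem on consecutive intervals. Differentiability is asked only inside them, because a
weight `(1-x)^(α+1)` need not be differentiable at the endpoint. -/
theorem exists_strictMono_deriv_eq_zero (n : ℕ) (e : ℕ → ℝ) (he : ∀ i ≤ n, e i < e (i + 1))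
    (g g' : ℝ → ℝ) (hg : Continuous g) (hg0 : ∀ i ≤ n + 1, g (e i) = 0)
    (hg' : ∀ i ≤ n, ∀ x ∈ Set.Ioo (e i) (e (i + 1)), HasDerivAt g (g' x) x) :
    ∃ z : Fin (n + 1) → ℝ, StrictMono z ∧ ∀ i : Fin (n + 1), z i ∈ Set.Ioo (e i) (e (i + 1)) ∧
      g' (z i) = 0 := by
  have h : ∀ i : Fin (n + 1), ∃ c ∈ Set.Ioo (e i) (e (i + 1)), g' c = 0 := fun i =>
    exists_hasDerivAt_eq_zero (he i (by omega)) hg.continuousOn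
      ((hg0 i (by omega)).trans (hg0 (i + 1) (by omega)).symm) (hg' i (by omega))
  choose z hz hz' using h
  refine ⟨z, ?_, fun i => ⟨hz i, hz' i⟩⟩
  rw [Fin.strictMono_iff_lt_succ]
  intro i
  exact (hz i.castSucc).2.trans (by simpa using (hz i.succ).1)

/-- Induction on `n` with both parameters raised: the weighted polynomial of degree `n` vanishes at
its `n` zeros and at `±1`, so its derivative, a positive weight times a nonzero multiple of
`jacobiPoly (n + 1) α β`, has `n + 1` zeros in the gaps. -/
theorem jacobiPoly_exists_roots (n : ℕ) (α β : ℝ) (hα : -1 < α) (hβ : -1 < β) :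
    ∃ z : Fin n → ℝ, StrictMono z ∧ ∀ i, z i ∈ Set.Ioo (-1) 1 ∧
      (jacobiPoly n α β).eval (z i) = 0 := by
  induction n generalizing α β with
  | zero => exact ⟨fun i => i.elim0, fun i => i.elim0, fun i => i.elim0⟩
  | succ n ih =>
    obtain ⟨z, hz, hz0⟩ := ih (α + 1) (β + 1) (by linarith) (by linarith)
    set K := jacobiPoly n (α + 1) (β + 1) with hK
    -- The nodes for Rolle: `-1`, then the zeros of `K`, then `1`.
    let e : ℕ → ℝ := fun i => if i = 0 then -1 else if h : i - 1 < n then z ⟨i - 1, h⟩ else 1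
    have he0 : e 0 = -1 := rfl
    have hemid : ∀ i (h : i < n), e (i + 1) = z ⟨i, h⟩ := fun i h => by simp [e, h]
    have helast : e (n + 1) = 1 := by simp [e]
    have hmem : ∀ i, e i ∈ Set.Icc (-1) 1 := by
      intro i
      simp only [e]
      split_ifs with h1 h2
      · simp
      · exact Set.Ioo_subset_Icc_self (hz0 _).1
      · simp
    have hlt : ∀ i ≤ n, e i < e (i + 1) := by
      intro i hi
      rcases i with _ | i
      · rcases Nat.eq_zero_or_pos n with h | h
        · subst h; rw [he0, helast]; norm_num
        · rw [he0, hemid 0 h]; exact (hz0 _).1.1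
      · rw [hemid i hi]
        rcases Nat.lt_or_ge (i + 1) n with h | h
        · rw [hemid _ h]; exact hz (by simp)
        · have : i + 1 = n := by omega
          rw [this, helast]; exact (hz0 _).1.2
    let g : ℝ → ℝ := fun x => (1 - x) ^ (α + 1) * (1 + x) ^ (β + 1) * K.eval x
    let g' : ℝ → ℝ := fun x => (1 - x) ^ α * (1 + x) ^ β *
      ((-2 * (n + 1)) * (jacobiPoly (n + 1) α β).eval x)
    have hg : Continuous g := by
      refine (Continuous.mul ?_ ?_).mul K.continuous
      · exact (continuous_const.sub continuous_id).rpow_const fun x => Or.inr (by linarith)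
      · exact (continuous_const.add continuous_id).rpow_const fun x => Or.inr (by linarith)
    have hg0 : ∀ i ≤ n + 1, g (e i) = 0 := by
      intro i hi
      rcases i with _ | i
      · simp [g, he0, Real.zero_rpow (by linarith : β + 1 ≠ 0)]
      · rcases Nat.lt_or_ge i n with h | h
        · simp [g, hemid i h, (hz0 ⟨i, h⟩).2]
        · have : i = n := by omega
          simp [g, this, helast, Real.zero_rpow (by linarith : α + 1 ≠ 0)]
    have hg' : ∀ i ≤ n, ∀ x ∈ Set.Ioo (e i) (e (i + 1)), HasDerivAt g (g' x) x := by
      intro i _ x hx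
      have h1 : 0 < 1 - x := by linarith [hx.2, (hmem (i + 1)).2]
      have h2 : 0 < 1 + x := by linarith [hx.1, (hmem i).1]
      have d1 : HasDerivAt (fun x : ℝ => (1 - x) ^ (α + 1)) (-1 * (α + 1) * (1 - x) ^ α) x := by
        simpa using ((hasDerivAt_id x).const_sub 1).rpow_const (p := α + 1) (Or.inl h1.ne')
      have d2 : HasDerivAt (fun x : ℝ => (1 + x) ^ (β + 1)) (1 * (β + 1) * (1 + x) ^ β) x := by
        simpa using ((hasDerivAt_id x).const_add 1).rpow_const (p := β + 1) (Or.inl h2.ne')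
      refine ((d1.mul d2).mul (K.hasDerivAt x)).congr_deriv ?_
      have := congrArg (eval x) (jacobiPoly_raise n α β)
      simp only [eval_add, eval_mul, eval_sub, eval_C, eval_X, eval_one, eval_pow, ← hK] at this
      simp only [g', ← this, Real.rpow_add h1, Real.rpow_add h2, Real.rpow_one, Pi.mul_apply]
      ring
    obtain ⟨y, hy, hy0⟩ := exists_strictMono_deriv_eq_zero n e hlt g g' hg hg0 hg'
    refine ⟨y, hy, fun i => ?_⟩
    have h1 : -1 < y i := (hmem i).1.trans_lt (hy0 i).1.1
    have h2 : y i < 1 := (hy0 i).1.2.trans_le (hmem _).2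
    refine ⟨⟨h1, h2⟩, ?_⟩
    have h3 := (Real.rpow_pos_of_pos (by linarith : 0 < 1 - y i) α).ne'
    have h4 := (Real.rpow_pos_of_pos (by linarith : 0 < 1 + y i) β).ne'
    have h5 : (-2 * ((n : ℝ) + 1)) ≠ 0 := by
      have : (0 : ℝ) < n + 1 := by positivity
      linarith
    have := (hy0 i).2
    simpa only [g', mul_eq_zero, h3, h4, h5, false_or] using this

/-! ### Chords of the unit circle. -/

theorem circPt_eq_mul_circPt_half (s t : ℝ) :
    circPt s = circPt ((s + t) / 2) * (Real.cos ((s - t) / 2) + Real.sin ((s - t) / 2) * Complex.I)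
    := by
  rw [circPt, circPt, Complex.ofReal_cos, Complex.ofReal_sin, ← Complex.exp_mul_I, ← Complex.exp_add]
  congr 1
  push_cast
  ring

theorem circPt_eq_mul_circPt_half' (s t : ℝ) :
    circPt t = circPt ((s + t) / 2) * (Real.cos ((s - t) / 2) - Real.sin ((s - t) / 2) * Complex.I)
    := by
  have h := circPt_eq_mul_circPt_half t s
  rwa [add_comm t s, show (t - s) / 2 = -((s - t) / 2) by ring, Real.cos_neg, Real.sin_neg,
    Complex.ofReal_neg, neg_mul, ← sub_eq_add_neg] at h

theorem circPt_ne_zero (t : ℝ) : circPt t ≠ 0 := Complex.exp_ne_zero _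

theorem norm_circPt (t : ℝ) : ‖circPt t‖ = 1 := Complex.norm_exp_ofReal_mul_I t

theorem circPt_sub_circPt (s t : ℝ) :
    circPt s - circPt t = circPt ((s + t) / 2) * (2 * Real.sin ((s - t) / 2) * Complex.I) := by
  rw [circPt_eq_mul_circPt_half s t, circPt_eq_mul_circPt_half' s t]
  generalize circPt ((s + t) / 2) = c
  ring

theorem circPt_add_circPt (s t : ℝ) :
    circPt s + circPt t = circPt ((s + t) / 2) * (2 * Real.cos ((s - t) / 2)) := by
  rw [circPt_eq_mul_circPt_half s t, circPt_eq_mul_circPt_half' s t]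
  generalize circPt ((s + t) / 2) = c
  ring

theorem norm_circPt_sub (s t : ℝ) :
    ‖circPt s - circPt t‖ = 2 * |Real.sin ((s - t) / 2)| := by
  rw [circPt_sub_circPt, norm_mul, norm_circPt, one_mul, norm_mul, norm_mul, Complex.norm_I,
    Complex.norm_real, Real.norm_eq_abs]
  simp

theorem ofReal_cot_half_sub (s t : ℝ) :
    ((Real.cos ((s - t) / 2) / Real.sin ((s - t) / 2) : ℝ) : ℂ) =
      Complex.I * ((circPt s + circPt t) / (circPt s - circPt t)) := by
  rw [circPt_sub_circPt, circPt_add_circPt, mul_div_mul_left _ _ (circPt_ne_zero _),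
    Complex.ofReal_div, mul_assoc, mul_div_mul_left _ _ two_ne_zero, div_mul_eq_div_div,
    Complex.div_I]
  linear_combination
    ((Real.cos ((s - t) / 2) : ℂ) / (Real.sin ((s - t) / 2) : ℂ)) * Complex.I_mul_I

theorem circPt_ne_of_sub_mem {s t : ℝ} (h : s - t ∈ Set.Ioo 0 (2 * Real.pi)) :
    circPt s ≠ circPt t := by
  rw [← sub_ne_zero, ← norm_ne_zero_iff, norm_circPt_sub]
  have : 0 < Real.sin ((s - t) / 2) :=
    Real.sin_pos_of_pos_of_lt_pi (by linarith [h.1]) (by linarith [h.2])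
  positivity

/-! ### Strict concavity of the logarithmic energy. -/

theorem sin_lt_tangent {a b : ℝ} (ha : a ∈ Set.Icc 0 Real.pi) (hb : b ∈ Set.Icc 0 Real.pi)
    (hab : a ≠ b) : Real.sin a < Real.sin b + Real.cos b * (a - b) := by
  rcases lt_or_gt_of_ne hab with h | h
  · have := strictConcaveOn_sin_Icc.lt_slope_of_hasDerivAt ha hb h (Real.hasDerivAt_sin b)
    rw [slope_def_field, lt_div_iff₀ (by linarith)] at this
    linarith
  · have := strictConcaveOn_sin_Icc.slope_lt_of_hasDerivAt hb ha h (Real.hasDerivAt_sin b)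
    rw [slope_def_field, div_lt_iff₀ (by linarith)] at this
    linarith

/-- The tangent inequality for `sin`, divided by `sin b`, combines with `log r ≤ r - 1` at `r = sin
a / sin b`. -/
theorem log_sin_lt_tangent {a b : ℝ} (ha : a ∈ Set.Ioo 0 Real.pi) (hb : b ∈ Set.Ioo 0 Real.pi)
    (hab : a ≠ b) :
    Real.log (Real.sin a) < Real.log (Real.sin b) + Real.cos b / Real.sin b * (a - b) := by
  have h1 := Real.sin_pos_of_mem_Ioo ha
  have h2 := Real.sin_pos_of_mem_Ioo hb
  have h3 := sin_lt_tangent (Set.Ioo_subset_Icc_self ha) (Set.Ioo_subset_Icc_self hb) hab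
  have h4 := Real.log_le_sub_one_of_pos (div_pos h1 h2)
  rw [Real.log_div h1.ne' h2.ne'] at h4
  have h5 : Real.sin a / Real.sin b < 1 + Real.cos b / Real.sin b * (a - b) := by
    rw [div_lt_iff₀ h2]
    field_simp
    linarith
  linarith

theorem log_norm_circPt_sub_lt_tangent {s t s' t' : ℝ} (h : s - t ∈ Set.Ioo 0 (2 * Real.pi))
    (h' : s' - t' ∈ Set.Ioo 0 (2 * Real.pi)) (hne : s' - t' ≠ s - t) :
    Real.log ‖circPt s' - circPt t'‖ < Real.log ‖circPt s - circPt t‖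
      + Real.cos ((s - t) / 2) / Real.sin ((s - t) / 2) * (((s' - t') - (s - t)) / 2) := by
  have m : (s - t) / 2 ∈ Set.Ioo 0 Real.pi := ⟨by linarith [h.1], by linarith [h.2]⟩
  have m' : (s' - t') / 2 ∈ Set.Ioo 0 Real.pi := ⟨by linarith [h'.1], by linarith [h'.2]⟩
  have p := Real.sin_pos_of_mem_Ioo m
  have p' := Real.sin_pos_of_mem_Ioo m'
  have key := log_sin_lt_tangent m' m (fun e => hne (by linarith))
  rw [norm_circPt_sub, norm_circPt_sub, abs_of_pos p, abs_of_pos p',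
    Real.log_mul two_ne_zero p.ne', Real.log_mul two_ne_zero p'.ne']
  rw [← sub_div] at key
  linarith

theorem log_norm_circPt_sub_le_tangent {s t s' t' : ℝ} (h : s - t ∈ Set.Ioo 0 (2 * Real.pi))
    (h' : s' - t' ∈ Set.Ioo 0 (2 * Real.pi)) :
    Real.log ‖circPt s' - circPt t'‖ ≤ Real.log ‖circPt s - circPt t‖
      + Real.cos ((s - t) / 2) / Real.sin ((s - t) / 2) * (((s' - t') - (s - t)) / 2) := by
  by_cases hne : s' - t' = s - t
  · rw [norm_circPt_sub, norm_circPt_sub, hne]; simp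
  · exact (log_norm_circPt_sub_lt_tangent h h' hne).le

theorem cot_half_sub_swap (s t : ℝ) : Real.cos ((t - s) / 2) / Real.sin ((t - s) / 2) =
    -(Real.cos ((s - t) / 2) / Real.sin ((s - t) / 2)) := by
  rw [show (t - s) / 2 = -((s - t) / 2) by ring, Real.cos_neg, Real.sin_neg, div_neg]

/-- Twice the logarithmic energy of charges `w a` at the points `e^{i x a}`; the diagonal terms
vanish because `Real.log 0 = 0`. -/
noncomputable def pairEnergy {ι : Type*} [Fintype ι] (w x : ι → ℝ) : ℝ :=
  ∑ a, ∑ b, w a * w b * Real.log ‖circPt (x a) - circPt (x b)‖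

/-- The tangent inequalities at `x` are summed over all pairs, and the linear part vanishes by
`hcrit`. Strictness comes from the pinned index `a₀`: a coordinate that moves changes its difference
with `a₀`. By `hsep` each pair has the same order in `x` and `y`, so one branch of concavity serves
both. -/
theorem pairEnergy_lt_of_critical {ι : Type*} [Fintype ι] {w x y : ι → ℝ}
    (hw : ∀ a, 0 < w a) {a₀ : ι} (h₀ : x a₀ = y a₀) (hne : x ≠ y)
    (hsep : ∀ a b, a ≠ b →
      (x a - x b ∈ Set.Ioo 0 (2 * Real.pi) ∧ y a - y b ∈ Set.Ioo 0 (2 * Real.pi)) ∨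
      (x b - x a ∈ Set.Ioo 0 (2 * Real.pi) ∧ y b - y a ∈ Set.Ioo 0 (2 * Real.pi)))
    (hcrit : ∀ a, ∑ b, w b * (Real.cos ((x a - x b) / 2) / Real.sin ((x a - x b) / 2)) = 0) :
    pairEnergy w y < pairEnergy w x := by
  set K : ι → ι → ℝ := fun a b => Real.cos ((x a - x b) / 2) / Real.sin ((x a - x b) / 2) with hK
  have hKswap : ∀ a b, K b a = -K a b := fun a b => cot_half_sub_swap _ _
  set T : ι → ι → ℝ := fun a b => K a b * (((y a - y b) - (x a - x b)) / 2) with hT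
  have hTswap : ∀ a b, T b a = T a b := fun a b => by simp only [hT, hKswap a b]; ring
  -- As the cotangent is odd, the sum regroups as displacement of `a` times total force on `a`.
  have hzero : ∑ a, ∑ b, w a * w b * T a b = 0 := by
    have e : ∀ a b, w a * w b * T a b =
        (y a - x a) / 2 * w a * (w b * K a b) + (y b - x b) / 2 * w b * (w a * K b a) := by
      intro a b; simp only [hT, hKswap a b]; ring
    simp only [e, Finset.sum_add_distrib]
    rw [Finset.sum_comm (f := fun a b => (y b - x b) / 2 * w b * (w a * K b a))]
    simp only [← Finset.mul_sum, hcrit, mul_zero, Finset.sum_const_zero, add_zero, hK]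
  have hle : ∀ a b, Real.log ‖circPt (y a) - circPt (y b)‖ ≤
      Real.log ‖circPt (x a) - circPt (x b)‖ + T a b := by
    intro a b
    by_cases hab : a = b
    · subst hab; simp [hT]
    · rcases hsep a b hab with h | h
      · exact log_norm_circPt_sub_le_tangent h.1 h.2
      · rw [norm_sub_rev, norm_sub_rev (circPt (x a)), ← hTswap]
        exact log_norm_circPt_sub_le_tangent h.1 h.2
  obtain ⟨c, hc⟩ := Function.ne_iff.mp hne
  have hc0 : c ≠ a₀ := fun e => hc (e ▸ h₀)
  have hlt : Real.log ‖circPt (y c) - circPt (y a₀)‖ <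
      Real.log ‖circPt (x c) - circPt (x a₀)‖ + T c a₀ := by
    rcases hsep c a₀ hc0 with h | h
    · exact log_norm_circPt_sub_lt_tangent h.1 h.2 fun e => hc (by linarith)
    · rw [norm_sub_rev, norm_sub_rev (circPt (x c)), ← hTswap]
      exact log_norm_circPt_sub_lt_tangent h.1 h.2 fun e => hc (by linarith)
  have hww : ∀ a b, 0 < w a * w b := fun a b => mul_pos (hw a) (hw b)
  calc pairEnergy w y
      < ∑ a, ∑ b, w a * w b * (Real.log ‖circPt (x a) - circPt (x b)‖ + T a b) := by
        refine Finset.sum_lt_sum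
          (fun a _ => Finset.sum_le_sum fun b _ => mul_le_mul_of_nonneg_left (hle a b) (hww a b).le)
          ⟨c, Finset.mem_univ _, Finset.sum_lt_sum
            (fun b _ => mul_le_mul_of_nonneg_left (hle c b) (hww c b).le)
            ⟨a₀, Finset.mem_univ _, mul_lt_mul_of_pos_left hlt (hww c a₀)⟩⟩
    _ = pairEnergy w x := by
        simp only [mul_add, Finset.sum_add_distrib, hzero, add_zero, pairEnergy]

/-! ### The Hamiltonian as a pair energy; convexity and order of the configuration space. -/

/-- The charge of each point of a configuration. -/
def charge (m n : ℕ) (p q : ℝ) : Fin m ⊕ Fin m ⊕ Fin (2 * m * n) → ℝ :=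
  Sum.elim (fun _ => p) (Sum.elim (fun _ => q) fun _ => 1)

/-- All angles of a configuration as one family. -/
def angles {m n : ℕ} (x : Config m n) : Fin m ⊕ Fin m ⊕ Fin (2 * m * n) → ℝ :=
  Sum.elim x.1 (Sum.elim x.2.1 x.2.2)

theorem angles_injective {m n : ℕ} : Function.Injective (angles (m := m) (n := n)) := by
  rintro ⟨a, b, c⟩ ⟨a', b', c'⟩ h
  simp only [angles, Sum.elim_eq_iff] at h
  simp [h]

theorem two_mul_sum_sum_Iio {N : ℕ} (f : Fin N → Fin N → ℝ) (h0 : ∀ j, f j j = 0)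
    (hs : ∀ j k, f j k = f k j) : 2 * ∑ j, ∑ k ∈ Finset.Iio j, f j k = ∑ j, ∑ k, f j k := by
  have e : ∑ j, ∑ k ∈ Finset.Iio j, f j k = ∑ j, ∑ k ∈ Finset.Ioi j, f j k := by
    rw [Finset.sum_comm' (t' := Finset.univ) (s' := fun k => Finset.Ioi k) (by simp)]
    exact Finset.sum_congr rfl fun j _ => Finset.sum_congr rfl fun k _ => hs _ _
  rw [two_mul]
  nth_rewrite 2 [e]
  rw [← Finset.sum_add_distrib]
  refine Finset.sum_congr rfl fun j _ => ?_
  have hu : (Finset.univ : Finset (Fin N)) = insert j (Finset.Iio j ∪ Finset.Ioi j) := by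
    ext k
    simpa [or_comm, or_assoc] using lt_trichotomy k j
  rw [hu, Finset.sum_insert (by simp), h0, zero_add, Finset.sum_union]
  rw [Finset.disjoint_left]
  intro k hk hk'
  exact lt_asymm (Finset.mem_Iio.mp hk) (Finset.mem_Ioi.mp hk')

theorem two_mul_hamiltonian (m n : ℕ) (p q : ℝ) (x : Config m n) :
    2 * hamiltonian m n p q x = pairEnergy (charge m n p q) (angles x) := by
  have h := fun (N : ℕ) (t : Fin N → ℝ) =>
    two_mul_sum_sum_Iio (fun j k => Real.log ‖circPt (t j) - circPt (t k)‖)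
      (fun j => by simp) (fun j k => by rw [norm_sub_rev])
  have h1 := h _ x.1
  have h2 := h _ x.2.1
  have h3 := h _ x.2.2
  have c : ∀ {M N : ℕ} (s : Fin M → ℝ) (t : Fin N → ℝ),
      ∑ j, ∑ k, Real.log ‖circPt (t j) - circPt (s k)‖ =
      ∑ j, ∑ k, Real.log ‖circPt (s j) - circPt (t k)‖ := by
    intro M N s t
    rw [Finset.sum_comm]
    simp only [norm_sub_rev]
  simp only [pairEnergy, charge, angles, Fintype.sum_sum_type, Sum.elim_inl, Sum.elim_inr,
    Finset.sum_add_distrib, ← Finset.mul_sum, one_mul, mul_one]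
  rw [c x.1 x.2.1, c x.1 x.2.2, c x.2.1 x.2.2, ← h1, ← h2, ← h3, hamiltonian]
  ring

theorem nextAngle_combo {m : ℕ} (φ φ' : Fin m → ℝ) (j : Fin m) {a b : ℝ} (hab : a + b = 1) :
    nextAngle (a • φ + b • φ') j = a * nextAngle φ j + b * nextAngle φ' j := by
  unfold nextAngle
  split_ifs
  · simp
  · rw [← add_mul, hab, one_mul]

theorem convex_combo_lt {a b s t s' t' : ℝ} (ha : 0 ≤ a) (hb : 0 ≤ b) (hab : a + b = 1)
    (h : s < t) (h' : s' < t') : a * s + b * s' < a * t + b * t' := by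
  rcases ha.eq_or_lt with rfl | ha
  · have : b = 1 := by linarith
    subst this; simpa using h'
  · have := mul_lt_mul_of_pos_left h ha
    have := mul_le_mul_of_nonneg_left h'.le hb
    linarith

theorem convex_configSpace (m n : ℕ) : Convex ℝ (configSpace m n) := by
  rintro x ⟨hx1, hx2, hx3, hx4⟩ y ⟨hy1, hy2, hy3, hy4⟩ a b ha hb hab
  have c := fun {s t s' t' : ℝ} => convex_combo_lt (s := s) (t := t) (s' := s') (t' := t') ha hb hab
  refine ⟨fun j hj => ?_, fun k l hkl => ?_, fun j k h1 h2 => ?_, fun j k h1 h2 => ?_⟩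
  · simp [hx1 j hj, hy1 j hj]
  · exact c (hx2 hkl) (hy2 hkl)
  · exact ⟨c (hx3 j k h1 h2).1 (hy3 j k h1 h2).1, c (hx3 j k h1 h2).2 (hy3 j k h1 h2).2⟩
  · refine ⟨c (hx4 j k h1 h2).1 (hy4 j k h1 h2).1, ?_⟩
    have := c (hx4 j k h1 h2).2 (hy4 j k h1 h2).2
    rw [← nextAngle_combo _ _ _ hab] at this
    exact this

section Order

variable {m n : ℕ} {x : Config m n}

/-- The defining inequalities concern one block only; its first index (present as `n ≥ 1`) and
monotonicity of `θ` give all later ones. -/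
theorem phi_lt_theta (hn : 1 ≤ n) (hx : x ∈ configSpace m n) {j : Fin m} {k : Fin (2 * m * n)}
    (h : 2 * (j : ℕ) * n ≤ k) : x.1 j < x.2.2 k := by
  refine lt_of_lt_of_le (hx.2.2.1 j ⟨2 * j * n, h.trans_lt k.2⟩ le_rfl ?_).1
    (hx.2.1.monotone (Fin.mk_le_of_le_val h))
  simp only
  nlinarith

theorem theta_lt_phi (hn : 1 ≤ n) (hx : x ∈ configSpace m n) {j : Fin m} {k : Fin (2 * m * n)}
    (h : (k : ℕ) < 2 * j * n) : x.2.2 k < x.1 j := by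
  -- For a successor index the last `θ` of the preceding block, at `2(j+1)n - 1`, lies below
  -- `nextAngle`, which is `φ (j+1)`.
  rcases j with ⟨_ | j, hj⟩
  · simp at h
  have hlt : 2 * (j + 1) * n - 1 < 2 * m * n := by
    have : (j + 1) * n < m * n := Nat.mul_lt_mul_of_pos_right hj hn
    have e1 : 2 * (j + 1) * n = 2 * ((j + 1) * n) := by ring
    have e2 : 2 * m * n = 2 * (m * n) := by ring
    omega
  simp only at h
  have := (hx.2.2.2 ⟨j, by omega⟩ ⟨2 * (j + 1) * n - 1, hlt⟩ ?_ ?_).2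
  · rw [nextAngle, dif_pos (by simpa using hj)] at this
    exact lt_of_le_of_lt (hx.2.1.monotone (Fin.le_def.mpr (by simp only; omega))) this
  · simp only
    have : 2 * (j + 1) * n = (2 * j + 1) * n + n := by ring
    omega
  · simp only
    have : 2 * (j + 1) * n = (2 * j + 2) * n := by ring
    omega

theorem two_mul_succ_mul_le {m n : ℕ} (j : Fin m) : (2 * (j : ℕ) + 2) * n ≤ 2 * m * n :=
  Nat.mul_le_mul_right _ (by omega)

theorem psi_lt_theta (hn : 1 ≤ n) (hx : x ∈ configSpace m n) {j : Fin m} {k : Fin (2 * m * n)}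
    (h : (2 * (j : ℕ) + 1) * n ≤ k) : x.2.1 j < x.2.2 k := by
  refine lt_of_lt_of_le (hx.2.2.2 j ⟨(2 * j + 1) * n, h.trans_lt k.2⟩ le_rfl ?_).1
    (hx.2.1.monotone (Fin.mk_le_of_le_val h))
  simp only
  nlinarith

theorem theta_lt_psi (hn : 1 ≤ n) (hx : x ∈ configSpace m n) {j : Fin m} {k : Fin (2 * m * n)}
    (h : (k : ℕ) < (2 * j + 1) * n) : x.2.2 k < x.2.1 j := by
  have e := two_mul_succ_mul_le (n := n) j
  have e1 : (2 * (j : ℕ) + 2) * n = (2 * j + 1) * n + n := by ring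
  have e2 : (2 * (j : ℕ) + 1) * n = 2 * j * n + n := by ring
  refine lt_of_le_of_lt (hx.2.1.monotone (Fin.le_def.mpr ?_))
    (hx.2.2.1 j ⟨(2 * j + 1) * n - 1, by omega⟩ ?_ ?_).2 <;> simp only <;> omega

/-- The definition never compares `φ` and `ψ` directly; a `θ` between them does. -/
theorem phi_lt_psi (hn : 1 ≤ n) (hx : x ∈ configSpace m n) {i j : Fin m} (h : i ≤ j) :
    x.1 i < x.2.1 j := by
  have e := two_mul_succ_mul_le (n := n) j
  have e1 : (2 * (j : ℕ) + 2) * n = 2 * j * n + 2 * n := by ring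
  have e2 : (2 * (j : ℕ) + 1) * n = 2 * j * n + n := by ring
  have e3 : 2 * (i : ℕ) * n ≤ 2 * j * n := Nat.mul_le_mul_right _ (by omega)
  exact (phi_lt_theta hn hx (k := ⟨2 * j * n, by omega⟩) e3).trans
    (theta_lt_psi hn hx (by simp only; omega))

theorem psi_lt_phi (hn : 1 ≤ n) (hx : x ∈ configSpace m n) {i j : Fin m} (h : i < j) :
    x.2.1 i < x.1 j := by
  have e := two_mul_succ_mul_le (n := n) i
  have e1 : (2 * (i : ℕ) + 2) * n = (2 * i + 1) * n + n := by ring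
  have e3 : (2 * (i : ℕ) + 2) * n ≤ 2 * j * n := Nat.mul_le_mul_right _ (by omega)
  exact (psi_lt_theta hn hx (k := ⟨(2 * i + 1) * n, by omega⟩) le_rfl).trans
    (theta_lt_phi hn hx (by simp only; omega))

theorem strictMono_phi (hn : 1 ≤ n) (hx : x ∈ configSpace m n) : StrictMono x.1 :=
  fun _ _ h => (phi_lt_psi hn hx le_rfl).trans (psi_lt_phi hn hx h)

theorem strictMono_psi (hn : 1 ≤ n) (hx : x ∈ configSpace m n) : StrictMono x.2.1 :=
  fun _ _ h => (psi_lt_phi hn hx h).trans (phi_lt_psi hn hx le_rfl)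

theorem theta_lt_two_pi (hn : 1 ≤ n) (hx : x ∈ configSpace m n) (k : Fin (2 * m * n)) :
    x.2.2 k < 2 * Real.pi := by
  have hm : 0 < m := by
    rcases Nat.eq_zero_or_pos m with rfl | h
    · exact absurd k.2 (by simp)
    · exact h
  obtain ⟨l, rfl⟩ : ∃ l, m = l + 1 := ⟨m - 1, by omega⟩
  have e0 := k.2
  have e1 : 2 * (l + 1) * n = (2 * l + 1) * n + n := by ring
  have e2 : 2 * (l + 1) * n = (2 * l + 2) * n := by ring
  have := (hx.2.2.2 ⟨l, by omega⟩ ⟨2 * (l + 1) * n - 1, by omega⟩ (by simp only; omega)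
    (by simp only; omega)).2
  rw [nextAngle, dif_neg (by simp)] at this
  exact lt_of_le_of_lt (hx.2.1.monotone (Fin.le_def.mpr (by simp only; omega))) this

theorem angles_mem_Ico (hn : 1 ≤ n) (hx : x ∈ configSpace m n)
    (a : Fin m ⊕ Fin m ⊕ Fin (2 * m * n)) : angles x a ∈ Set.Ico 0 (2 * Real.pi) := by
  have hnn : ∀ j, 0 ≤ x.1 j := fun j => by
    rw [← hx.1 ⟨0, j.pos⟩ rfl]
    exact (strictMono_phi hn hx).monotone (Fin.mk_le_of_le_val (Nat.zero_le _))
  have hψ : ∀ j, x.2.1 j < 2 * Real.pi := fun j => by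
    have e := two_mul_succ_mul_le (n := n) j
    have e1 : (2 * (j : ℕ) + 2) * n = (2 * j + 1) * n + n := by ring
    exact (psi_lt_theta hn hx (k := ⟨(2 * j + 1) * n, by omega⟩) le_rfl).trans
      (theta_lt_two_pi hn hx _)
  rcases a with j | j | k
  · exact ⟨hnn j, (phi_lt_psi hn hx le_rfl).trans (hψ j)⟩
  · exact ⟨(hnn j).trans (phi_lt_psi hn hx le_rfl).le, hψ j⟩
  · refine ⟨?_, theta_lt_two_pi hn hx k⟩
    have hm : 0 < m := by
      rcases Nat.eq_zero_or_pos m with rfl | h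
      · exact absurd k.2 (by simp)
      · exact h
    exact (hnn ⟨0, hm⟩).trans (phi_lt_theta hn hx (by simp)).le

end Order

/-- The disjunction stands outside the quantifiers: the order depends on the labels alone, as `hsep`
in `pairEnergy_lt_of_critical` requires. -/
theorem angles_order (m : ℕ) {n : ℕ} (hn : 1 ≤ n) (a b : Fin m ⊕ Fin m ⊕ Fin (2 * m * n))
    (hab : a ≠ b) : (∀ x ∈ configSpace m n, angles x a < angles x b) ∨
      (∀ x ∈ configSpace m n, angles x b < angles x a) := by
  rcases a with i | i | k <;> rcases b with j | j | l
  · rcases lt_or_gt_of_ne (fun e => hab (e ▸ rfl) : i ≠ j) with h | h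
    · exact Or.inl fun x hx => strictMono_phi hn hx h
    · exact Or.inr fun x hx => strictMono_phi hn hx h
  · rcases le_or_gt i j with h | h
    · exact Or.inl fun x hx => phi_lt_psi hn hx h
    · exact Or.inr fun x hx => psi_lt_phi hn hx h
  · rcases le_or_gt (2 * (i : ℕ) * n) l with h | h
    · exact Or.inl fun x hx => phi_lt_theta hn hx h
    · exact Or.inr fun x hx => theta_lt_phi hn hx h
  · rcases le_or_gt j i with h | h
    · exact Or.inr fun x hx => phi_lt_psi hn hx h
    · exact Or.inl fun x hx => psi_lt_phi hn hx h
  · rcases lt_or_gt_of_ne (fun e => hab (e ▸ rfl) : i ≠ j) with h | h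
    · exact Or.inl fun x hx => strictMono_psi hn hx h
    · exact Or.inr fun x hx => strictMono_psi hn hx h
  · rcases le_or_gt ((2 * (i : ℕ) + 1) * n) l with h | h
    · exact Or.inl fun x hx => psi_lt_theta hn hx h
    · exact Or.inr fun x hx => theta_lt_psi hn hx h
  · rcases le_or_gt (2 * (j : ℕ) * n) k with h | h
    · exact Or.inr fun x hx => phi_lt_theta hn hx h
    · exact Or.inl fun x hx => theta_lt_phi hn hx h
  · rcases le_or_gt ((2 * (j : ℕ) + 1) * n) k with h | h
    · exact Or.inr fun x hx => psi_lt_theta hn hx h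
    · exact Or.inl fun x hx => theta_lt_psi hn hx h
  · rcases lt_or_gt_of_ne (fun e => hab (e ▸ rfl) : k ≠ l) with h | h
    · exact Or.inl fun x hx => hx.2.1 h
    · exact Or.inr fun x hx => hx.2.1 h

theorem sub_mem_Ioo_of_mem_Ico {s t c : ℝ} (hs : s ∈ Set.Ico 0 c) (ht : t ∈ Set.Ico 0 c)
    (h : t < s) : s - t ∈ Set.Ioo 0 c := ⟨by linarith, by linarith [hs.2, ht.1]⟩

theorem circPt_angles_injective {m n : ℕ} (hn : 1 ≤ n) {x : Config m n} (hx : x ∈ configSpace m n) :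
    Function.Injective fun a => circPt (angles x a) := by
  intro a b h
  by_contra hab
  rcases angles_order m hn a b hab with o | o
  · exact circPt_ne_of_sub_mem (sub_mem_Ioo_of_mem_Ico (angles_mem_Ico hn hx b)
      (angles_mem_Ico hn hx a) (o x hx)) h.symm
  · exact circPt_ne_of_sub_mem (sub_mem_Ioo_of_mem_Ico (angles_mem_Ico hn hx a)
      (angles_mem_Ico hn hx b) (o x hx)) h

theorem hamiltonian_lt_of_critical {m n : ℕ} (hm : 1 ≤ m) (hn : 1 ≤ n) {p q : ℝ} (hp : 0 < p)
    (hq : 0 < q) {x y : Config m n} (hx : x ∈ configSpace m n) (hy : y ∈ configSpace m n)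
    (hne : x ≠ y)
    (hcrit : ∀ a, ∑ b, charge m n p q b * (Real.cos ((angles x a - angles x b) / 2) /
      Real.sin ((angles x a - angles x b) / 2)) = 0) :
    hamiltonian m n p q y < hamiltonian m n p q x := by
  have key : pairEnergy (charge m n p q) (angles y) < pairEnergy (charge m n p q) (angles x) := by
    refine pairEnergy_lt_of_critical (a₀ := Sum.inl ⟨0, hm⟩) ?_ ?_ (angles_injective.ne hne) ?_ hcrit
    · rintro (_ | _ | _) <;> simp [charge, hp, hq]
    · exact (hx.1 ⟨0, hm⟩ rfl).trans (hy.1 ⟨0, hm⟩ rfl).symm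
    · intro a b hab
      have s := fun (z : Config m n) (hz : z ∈ configSpace m n) a b =>
        sub_mem_Ioo_of_mem_Ico (angles_mem_Ico hn hz a) (angles_mem_Ico hn hz b)
      rcases angles_order m hn a b hab with o | o
      · exact Or.inr ⟨s x hx b a (o x hx), s y hy b a (o y hy)⟩
      · exact Or.inl ⟨s x hx a b (o x hx), s y hy a b (o y hy)⟩
  rw [← two_mul_hamiltonian, ← two_mul_hamiltonian] at key
  linarith

/-! ### Force sums over the roots of a polynomial. -/

section RootSums

variable {ι : Type*}

theorem eval_derivative_prod_X_sub_C (s : Finset ι) (z : ι → ℂ) (w : ℂ)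
    (hw : ∀ i ∈ s, w ≠ z i) :
    (derivative (∏ i ∈ s, (X - C (z i)))).eval w =
      (∏ i ∈ s, (X - C (z i))).eval w * ∑ i ∈ s, 1 / (w - z i) := by
  classical
  induction s using Finset.induction_on with
  | empty => simp
  | insert a s ha ih =>
    have h1 : w - z a ≠ 0 := sub_ne_zero.mpr (hw a (Finset.mem_insert_self _ _))
    rw [Finset.prod_insert ha, Finset.sum_insert ha, derivative_mul, eval_add, eval_mul, eval_mul,
      eval_mul, ih fun i hi => hw i (Finset.mem_insert_of_mem hi)]
    simp only [derivative_sub, derivative_X, derivative_C, sub_zero, eval_one, eval_sub, eval_X,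
      eval_C]
    field_simp

theorem sum_add_div_sub (s : Finset ι) (z : ι → ℂ) (w : ℂ) (hw : ∀ i ∈ s, w ≠ z i) :
    ∑ i ∈ s, (w + z i) / (w - z i) = 2 * w * (∑ i ∈ s, 1 / (w - z i)) - s.card := by
  rw [Finset.card_eq_sum_ones, Nat.cast_sum, Finset.mul_sum, ← Finset.sum_sub_distrib]
  refine Finset.sum_congr rfl fun i hi => ?_
  have := sub_ne_zero.mpr (hw i hi)
  field_simp
  push_cast
  ring

variable [Fintype ι] {R : ℂ[X]} {z : ι → ℂ}

theorem eq_C_mul_prod_X_sub_C (hz : Function.Injective z) (hdeg : R.natDegree ≤ Fintype.card ι)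
    (hroot : ∀ i, R.eval (z i) = 0) : R = C R.leadingCoeff * ∏ i, (X - C (z i)) := by
  refine eq_leadingCoeff_mul_of_monic_of_dvd_of_natDegree_le (monic_prod_X_sub_C _ _) ?_ ?_
  · refine Finset.prod_dvd_of_coprime ?_ fun i _ => dvd_iff_isRoot.mpr (hroot i)
    exact fun i _ j _ hij => pairwise_coprime_X_sub_C hz hij
  · rw [natDegree_prod_of_monic _ _ fun i _ => monic_X_sub_C _]
    simpa using hdeg

theorem sum_add_div_sub_of_eval_ne_zero (hz : Function.Injective z)
    (hdeg : R.natDegree ≤ Fintype.card ι) (hroot : ∀ i, R.eval (z i) = 0) {w : ℂ}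
    (hw : R.eval w ≠ 0) :
    ∑ i, (w + z i) / (w - z i) = 2 * (w * (derivative R).eval w / R.eval w) - Fintype.card ι := by
  have hne : ∀ i ∈ Finset.univ, w ≠ z i := fun i _ e => hw (e ▸ hroot i)
  have hR := eq_C_mul_prod_X_sub_C hz hdeg hroot
  set P : ℂ[X] := ∏ i, (X - C (z i)) with hP
  have h1 : R.eval w = R.leadingCoeff * P.eval w := by conv_lhs => rw [hR, eval_C_mul]
  have h2 : (derivative R).eval w = R.leadingCoeff * (P.eval w * ∑ i, 1 / (w - z i)) := by
    conv_lhs => rw [hR, derivative_C_mul, eval_C_mul, eval_derivative_prod_X_sub_C _ _ _ hne]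
  have h3 : (derivative R).eval w / R.eval w = ∑ i, 1 / (w - z i) := by
    rw [div_eq_iff hw, h1, h2]; ring
  rw [sum_add_div_sub _ _ _ hne, mul_div_assoc, h3, Finset.card_univ]
  ring

/-- Writing `R = (X - z a) S` up to the leading coefficient, `R'(z a) = S(z a)` and `R''(z a) = 2
S'(z a)`, so the logarithmic derivative of `S` is `R''/(2R')`. -/
theorem eval_derivative_ne_zero_and_sum_add_div_sub (hz : Function.Injective z) (hR0 : R ≠ 0)
    (hdeg : R.natDegree ≤ Fintype.card ι) (hroot : ∀ i, R.eval (z i) = 0) (a : ι) :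
    (derivative R).eval (z a) ≠ 0 ∧
    ∑ i, (z a + z i) / (z a - z i) =
      z a * (derivative (derivative R)).eval (z a) / (derivative R).eval (z a)
        - (Fintype.card ι - 1) := by
  classical
  have hne : ∀ i ∈ Finset.univ.erase a, z a ≠ z i := fun i hi e =>
    (Finset.mem_erase.mp hi).1 (hz e.symm)
  have hR := eq_C_mul_prod_X_sub_C hz hdeg hroot
  set S : ℂ[X] := ∏ i ∈ Finset.univ.erase a, (X - C (z i)) with hS
  have hl : R.leadingCoeff ≠ 0 := leadingCoeff_ne_zero.mpr hR0
  have hS0 : S.eval (z a) ≠ 0 := by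
    rw [hS, eval_prod, Finset.prod_ne_zero_iff]
    intro i hi
    simpa using sub_ne_zero.mpr (hne i hi)
  have hS' := eval_derivative_prod_X_sub_C _ z (z a) hne
  rw [← hS] at hS'
  rw [← Finset.mul_prod_erase _ _ (Finset.mem_univ a), ← hS] at hR
  have h1 : (derivative R).eval (z a) = R.leadingCoeff * S.eval (z a) := by
    conv_lhs => rw [hR]
    simp
  have h2 : (derivative (derivative R)).eval (z a) =
      2 * R.leadingCoeff * (derivative S).eval (z a) := by
    conv_lhs => rw [hR]
    simp
    ring
  refine ⟨by rw [h1]; exact mul_ne_zero hl hS0, ?_⟩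
  -- The term `i = a` is a division by zero, hence `0`: no self-force.
  rw [← Finset.add_sum_erase _ _ (Finset.mem_univ a), sub_self, div_zero, zero_add,
    sum_add_div_sub _ _ _ hne, h1, h2, hS', Finset.card_erase_of_mem (Finset.mem_univ a),
    Finset.card_univ, Nat.cast_sub (Fintype.card_pos_iff.mpr ⟨a⟩)]
  field_simp
  simp

end RootSums

/-! ### Derivatives of `circlePoly` and the force balance. -/

section CirclePoly

variable {m n : ℕ} {P : ℝ[X]} {z : ℂ}

theorem hasDerivAt_pow_div (k : ℕ) (hz : z ≠ 0) :
    HasDerivAt (fun z : ℂ => z ^ k) (k * z ^ k / z) z := by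
  refine (hasDerivAt_pow k z).congr_deriv ?_
  rcases k with _ | k
  · simp
  · rw [Nat.add_sub_cancel, pow_succ]; field_simp

/-- With `u = (z^m + z^{-m})/2` and `v = (z^m - z^{-m})/2`, the operator `z d/dz` sends `u` to `m v`
and `v` to `m u`. -/
theorem hasDerivAt_joukowski (m : ℕ) (hz : z ≠ 0) :
    HasDerivAt (fun z : ℂ => z ^ m / 2 + 1 / (2 * z ^ m))
      (m * (z ^ m / 2 - 1 / (2 * z ^ m)) / z) z := by
  have h := hasDerivAt_pow_div m hz
  have hw : z ^ m ≠ 0 := pow_ne_zero _ hz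
  refine ((h.div_const 2).add ((hasDerivAt_const z (1 : ℂ)).div (h.const_mul 2)
    (mul_ne_zero two_ne_zero hw))).congr_deriv ?_
  field_simp
  ring

theorem hasDerivAt_joukowski_conj (m : ℕ) (hz : z ≠ 0) :
    HasDerivAt (fun z : ℂ => z ^ m / 2 - 1 / (2 * z ^ m))
      (m * (z ^ m / 2 + 1 / (2 * z ^ m)) / z) z := by
  have h := hasDerivAt_pow_div m hz
  have hw : z ^ m ≠ 0 := pow_ne_zero _ hz
  refine ((h.div_const 2).sub ((hasDerivAt_const z (1 : ℂ)).div (h.const_mul 2)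
    (mul_ne_zero two_ne_zero hw))).congr_deriv ?_
  field_simp
  ring

theorem mul_eval_derivative_circlePoly (hP : P.natDegree ≤ n) (hz : z ≠ 0) :
    z * (derivative (circlePoly m n P)).eval z = z ^ (m * n) *
      (m * n * aeval (z ^ m / 2 + 1 / (2 * z ^ m)) P +
        m * (z ^ m / 2 - 1 / (2 * z ^ m)) * aeval (z ^ m / 2 + 1 / (2 * z ^ m)) (derivative P)) := by
  have h1 : HasDerivAt (fun z : ℂ => z ^ (m * n) * aeval (z ^ m / 2 + 1 / (2 * z ^ m)) P)
      _ z := (hasDerivAt_pow_div (m * n) hz).mul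
        ((P.hasDerivAt_aeval _).comp z (hasDerivAt_joukowski m hz))
  have h2 : (fun z : ℂ => (circlePoly m n P).eval z) =ᶠ[nhds z]
      fun z : ℂ => z ^ (m * n) * aeval (z ^ m / 2 + 1 / (2 * z ^ m)) P := by
    filter_upwards [isOpen_ne.mem_nhds hz] with y hy using circlePoly_eval m n P hP y hy
  rw [((circlePoly m n P).hasDerivAt z).unique (h1.congr_of_eventuallyEq h2)]
  push_cast
  field_simp

theorem mul_eval_derivative_derivative_circlePoly (hP : P.natDegree ≤ n) (hz : z ≠ 0) :
    z * ((derivative (circlePoly m n P)).eval z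
      + z * (derivative (derivative (circlePoly m n P))).eval z) = z ^ (m * n) * m ^ 2 *
      (n ^ 2 * aeval (z ^ m / 2 + 1 / (2 * z ^ m)) P +
        (2 * n * (z ^ m / 2 - 1 / (2 * z ^ m)) + (z ^ m / 2 + 1 / (2 * z ^ m))) *
          aeval (z ^ m / 2 + 1 / (2 * z ^ m)) (derivative P) +
        (z ^ m / 2 - 1 / (2 * z ^ m)) ^ 2 *
          aeval (z ^ m / 2 + 1 / (2 * z ^ m)) (derivative (derivative P))) := by
  have hu := hasDerivAt_joukowski m hz
  have h1 := (hasDerivAt_pow_div (m * n) hz).mul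
    ((((P.hasDerivAt_aeval _).comp z hu).const_mul ((m : ℂ) * n)).add
      (((hasDerivAt_joukowski_conj m hz).const_mul (m : ℂ)).mul
        (((derivative P).hasDerivAt_aeval _).comp z hu)))
  have h3 := (hasDerivAt_id z).mul ((derivative (circlePoly m n P)).hasDerivAt z)
  have h4 := h3.unique (h1.congr_of_eventuallyEq (by
    filter_upwards [isOpen_ne.mem_nhds hz] with y hy
    simpa using mul_eval_derivative_circlePoly hP hy))
  simp only [id, one_mul, Pi.mul_apply, Pi.add_apply, Function.comp] at h4
  rw [h4]
  push_cast
  have hw : z ^ m ≠ 0 := pow_ne_zero _ hz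
  field_simp
  ring

theorem circlePoly_natDegree_le (m n : ℕ) (P : ℝ[X]) :
    (circlePoly m n P).natDegree ≤ 2 * m * n := by
  refine natDegree_sum_le_of_forall_le _ _ fun k hk => ?_
  have hk' : k ≤ n := Nat.lt_succ_iff.mp (Finset.mem_range.mp hk)
  have h1 : (C (P.coeff k : ℂ) * X ^ (m * (n - k)) : ℂ[X]).natDegree ≤ m * (n - k) :=
    natDegree_C_mul_X_pow_le _ _
  have h2 : (C (1 / 2 : ℂ) * (X ^ (2 * m) + 1) : ℂ[X]).natDegree ≤ 2 * m :=
    (natDegree_C_mul_le _ _).trans (natDegree_add_le_of_degree_le (natDegree_X_pow_le _) (by simp))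
  calc _ ≤ m * (n - k) + k * (2 * m) :=
        natDegree_mul_le.trans (Nat.add_le_add h1 (natDegree_pow_le_of_le k h2))
    _ ≤ 2 * m * n := by
        obtain ⟨l, rfl⟩ := Nat.exists_eq_add_of_le hk'
        rw [Nat.add_sub_cancel_left]
        nlinarith

theorem circlePoly_jacobiPoly_ne_zero (m n : ℕ) {α β : ℝ} (hα : -1 < α) :
    circlePoly m n (jacobiPoly n α β) ≠ 0 := by
  intro h
  have h1 := circlePoly_eval m n _ (jacobiPoly_natDegree_le n α β) 1 one_ne_zero
  rw [h] at h1
  norm_num at h1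
  rw [show (1 : ℂ) = algebraMap ℝ ℂ 1 by simp, aeval_algebraMap_apply] at h1
  have h2 := jacobiPoly_eval_one_pos n α β hα
  simp [aeval_def] at h1
  exact h2.ne' (by exact_mod_cast h1.symm)

end CirclePoly

theorem aeval_jacobiPoly_ode (n : ℕ) (hn : 1 ≤ n) (α β : ℝ) (u : ℂ) :
    (1 - u ^ 2) * aeval u (derivative (derivative (jacobiPoly n α β)))
      + ((β : ℂ) - α - (α + β + 2) * u) * aeval u (derivative (jacobiPoly n α β))
      + (n : ℂ) * (n + α + β + 1) * aeval u (jacobiPoly n α β) = 0 := by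
  have h := congrArg (aeval u) (jacobiPoly_ode n hn α β)
  simpa using h

/-- At a zero the term in `P(u)` drops out of the differential equation, which then fixes `P''/P'`
at `u` and so `z Q''/Q'` for `Q = circlePoly`. The right side is minus the force of the charges `p`
and `q`. -/
theorem sum_add_div_sub_roots_jacobi {m n : ℕ} (hm : 1 ≤ m) (hn : 1 ≤ n) {p q : ℝ} (hp : 0 < p)
    {z : Fin (2 * m * n) → ℂ} (hz : Function.Injective z)
    (hroot : ∀ i, (circlePoly m n (jacobiPoly n (p - 1 / 2) (q - 1 / 2))).eval (z i) = 0)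
    (a : Fin (2 * m * n)) (h0 : z a ≠ 0) (h1 : z a ^ m - 1 ≠ 0) (h2 : z a ^ m + 1 ≠ 0) :
    ∑ i, (z a + z i) / (z a - z i) =
      -(m * (p * ((z a ^ m + 1) / (z a ^ m - 1)) + q * ((z a ^ m - 1) / (z a ^ m + 1)))) := by
  have hdeg := jacobiPoly_natDegree_le n (p - 1 / 2) (q - 1 / 2)
  obtain ⟨hd, hs⟩ := eval_derivative_ne_zero_and_sum_add_div_sub hz
    (circlePoly_jacobiPoly_ne_zero m n (by linarith)) (by
      simpa using circlePoly_natDegree_le m n (jacobiPoly n (p - 1 / 2) (q - 1 / 2))) hroot a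
  have e0 := circlePoly_eval m n _ hdeg (z a) h0
  have e1 := mul_eval_derivative_circlePoly (m := m) hdeg h0
  have e2 := mul_eval_derivative_derivative_circlePoly (m := m) hdeg h0
  have ode := aeval_jacobiPoly_ode n hn (p - 1 / 2) (q - 1 / 2)
    (z a ^ m / 2 + 1 / (2 * z a ^ m))
  rw [hroot a] at e0
  have hP : aeval (z a ^ m / 2 + 1 / (2 * z a ^ m)) (jacobiPoly n (p - 1 / 2) (q - 1 / 2)) = 0 :=
    (mul_eq_zero.mp e0.symm).resolve_left (pow_ne_zero _ h0)
  rw [hP] at e1 e2 ode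
  rw [hs, Fintype.card_fin]
  generalize (derivative (circlePoly m n (jacobiPoly n (p - 1 / 2) (q - 1 / 2)))).eval (z a) = Q₁
    at *
  generalize (derivative (derivative
    (circlePoly m n (jacobiPoly n (p - 1 / 2) (q - 1 / 2))))).eval (z a) = Q₂ at *
  generalize aeval (z a ^ m / 2 + 1 / (2 * z a ^ m))
    (derivative (derivative (jacobiPoly n (p - 1 / 2) (q - 1 / 2)))) = P₂ at *
  generalize aeval (z a ^ m / 2 + 1 / (2 * z a ^ m))
    (derivative (jacobiPoly n (p - 1 / 2) (q - 1 / 2))) = P₁ at *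
  have hw : z a ^ m ≠ 0 := pow_ne_zero _ h0
  have hk : z a ^ (m * n) ≠ 0 := pow_ne_zero _ h0
  have hm' : (m : ℂ) ≠ 0 := by exact_mod_cast (by omega : m ≠ 0)
  generalize z a ^ m = w at *
  generalize z a ^ (m * n) = k at *
  generalize z a = y at *
  have hv0 : w / 2 - 1 / (2 * w) ≠ 0 := by
    rw [show w / 2 - 1 / (2 * w) = (w - 1) * (w + 1) / (2 * w) by field_simp; ring]
    exact div_ne_zero (mul_ne_zero h1 h2) (mul_ne_zero two_ne_zero hw)
  have hvu : (w / 2 - 1 / (2 * w)) ^ 2 = (w / 2 + 1 / (2 * w)) ^ 2 - 1 := by field_simp; ring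
  have r1 : (w + 1) / (w - 1) = ((w / 2 + 1 / (2 * w)) + 1) / (w / 2 - 1 / (2 * w)) := by
    rw [div_eq_div_iff h1 hv0]; field_simp; ring
  have r2 : (w - 1) / (w + 1) = ((w / 2 + 1 / (2 * w)) - 1) / (w / 2 - 1 / (2 * w)) := by
    rw [div_eq_div_iff h2 hv0]; field_simp; ring
  rw [r1, r2]
  generalize w / 2 - 1 / (2 * w) = v at *
  generalize w / 2 + 1 / (2 * w) = u at *
  -- The claim with denominators cleared; `P₁` and `P₂` are eliminated using the equation and `v^2 =
  -- u^2 - 1`.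
  have key : (Q₁ + y * Q₂) * v = m * (2 * n * v + q - p - (p + q) * u) * Q₁ := by
    refine mul_left_cancel₀ h0 ?_
    push_cast at ode
    linear_combination v * e2 - m * (2 * n * v + q - p - (p + q) * u) * e1
      - k * m ^ 2 * v * ode + k * m ^ 2 * v * P₂ * hvu
  push_cast
  field_simp
  linear_combination key

section PowRoots

variable {m : ℕ} {c : ℂ} {z : Fin m → ℂ}

theorem sum_add_div_sub_pow_roots (hz : Function.Injective z) (hroot : ∀ i, z i ^ m = c) {w : ℂ}
    (hw : w ^ m - c ≠ 0) : ∑ i, (w + z i) / (w - z i) = m * ((w ^ m + c) / (w ^ m - c)) := by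
  have h := sum_add_div_sub_of_eval_ne_zero (R := X ^ m - C c) (w := w) hz
    (by rw [natDegree_X_pow_sub_C]; simp) (fun i => by simp [hroot i]) (by simpa using hw)
  rw [h]
  rcases m with _ | m
  · simp
  · simp only [derivative_sub, derivative_X_pow, derivative_C, eval_sub, eval_mul, eval_pow, eval_X,
      eval_C, Fintype.card_fin, sub_zero, Nat.add_sub_cancel]
    field_simp
    ring

theorem sum_add_div_sub_pow_roots_self (hc : c ≠ 0) (hz : Function.Injective z)
    (hroot : ∀ i, z i ^ m = c) (a : Fin m) : ∑ i, (z a + z i) / (z a - z i) = 0 := by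
  have h0 : z a ≠ 0 := fun h => hc (by rw [← hroot a, h, zero_pow a.pos.ne'])
  obtain ⟨m, rfl⟩ : ∃ k, m = k + 1 := ⟨m - 1, by have := a.pos; omega⟩
  have h := (eval_derivative_ne_zero_and_sum_add_div_sub (R := X ^ (m + 1) - C c) hz
    (X_pow_sub_C_ne_zero (by omega) c) (by rw [natDegree_X_pow_sub_C]; simp)
    (fun i => by simp [hroot i]) a)
  obtain ⟨hd, h⟩ := h
  rw [h, sub_eq_zero, div_eq_iff hd]
  rcases m with _ | m
  · simp
  · simp
    ring

end PowRoots

/-- Where `w^(2m) = 1`, the derivative of `u` vanishes, so `w Q'/Q = mn` for `Q = circlePoly`, half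
the number of roots. -/
theorem sum_add_div_sub_circlePoly_roots {m n : ℕ} {P : ℝ[X]} (hP : P.natDegree ≤ n)
    {z : Fin (2 * m * n) → ℂ} (hz : Function.Injective z)
    (hroot : ∀ i, (circlePoly m n P).eval (z i) = 0) {w : ℂ} (h0 : w ≠ 0)
    (hw : (circlePoly m n P).eval w ≠ 0) (hw2 : (w ^ m) ^ 2 = 1) :
    ∑ i, (w + z i) / (w - z i) = 0 := by
  rw [sum_add_div_sub_of_eval_ne_zero hz (by simpa using circlePoly_natDegree_le m n P) hroot hw,
    mul_eval_derivative_circlePoly hP h0]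
  have hwm : w ^ m ≠ 0 := pow_ne_zero _ h0
  have hv : w ^ m / 2 - 1 / (2 * w ^ m) = 0 := by
    field_simp
    linear_combination hw2
  rw [hv, mul_zero, zero_mul, add_zero, mul_left_comm, ← circlePoly_eval m n P hP w h0,
    mul_div_cancel_right₀ _ hw]
  simp
  ring

/-- The conditions that describe the extremal configuration. -/
def IsJacobiConfig (m n : ℕ) (p q : ℝ) (x : Config m n) : Prop :=
  Set.range (fun j => circPt (x.1 j)) = {z : ℂ | z ^ m = 1} ∧
  Set.range (fun j => circPt (x.2.1 j)) = {z : ℂ | z ^ m = -1} ∧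
  Set.range (fun k => circPt (x.2.2 k)) =
    {z : ℂ | (circlePoly m n (jacobiPoly n (p - 1 / 2) (q - 1 / 2))).eval z = 0}

theorem IsJacobiConfig.critical {m n : ℕ} (hm : 1 ≤ m) (hn : 1 ≤ n) {p q : ℝ} (hp : 0 < p)
    {x : Config m n} (hx : x ∈ configSpace m n) (h : IsJacobiConfig m n p q x)
    (a : Fin m ⊕ Fin m ⊕ Fin (2 * m * n)) :
    ∑ b, charge m n p q b * (Real.cos ((angles x a - angles x b) / 2) /
      Real.sin ((angles x a - angles x b) / 2)) = 0 := by
  obtain ⟨hφ, hψ, hθ⟩ := h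
  have inj := circPt_angles_injective hn hx
  have φi : Function.Injective fun j => circPt (x.1 j) := inj.comp Sum.inl_injective
  have ψi : Function.Injective fun j => circPt (x.2.1 j) :=
    inj.comp (Sum.inr_injective.comp Sum.inl_injective)
  have θi : Function.Injective fun k => circPt (x.2.2 k) :=
    inj.comp (Sum.inr_injective.comp Sum.inr_injective)
  have φr : ∀ j, circPt (x.1 j) ^ m = 1 := fun j => hφ.subset ⟨j, rfl⟩
  have ψr : ∀ j, circPt (x.2.1 j) ^ m = -1 := fun j => hψ.subset ⟨j, rfl⟩
  have θr : ∀ k, (circlePoly m n (jacobiPoly n (p - 1 / 2) (q - 1 / 2))).eval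
    (circPt (x.2.2 k)) = 0 := fun k => hθ.subset ⟨k, rfl⟩
  -- The three root sets are disjoint because a common element would put two distinct labels at one
  -- point.
  have φθ : ∀ j, (circlePoly m n (jacobiPoly n (p - 1 / 2) (q - 1 / 2))).eval
      (circPt (x.1 j)) ≠ 0 := fun j hj => by
    obtain ⟨k, hk⟩ := hθ.superset hj
    exact Sum.inr_ne_inl (@inj (Sum.inr (Sum.inr k)) (Sum.inl j) hk)
  have ψθ : ∀ j, (circlePoly m n (jacobiPoly n (p - 1 / 2) (q - 1 / 2))).eval
      (circPt (x.2.1 j)) ≠ 0 := fun j hj => by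
    obtain ⟨k, hk⟩ := hθ.superset hj
    exact Sum.inr_ne_inl (Sum.inr_injective (@inj (Sum.inr (Sum.inr k)) (Sum.inr (Sum.inl j)) hk))
  have θφ : ∀ k, circPt (x.2.2 k) ^ m - 1 ≠ 0 := fun k hk => by
    obtain ⟨j, hj⟩ := hφ.superset (sub_eq_zero.mp hk)
    exact Sum.inl_ne_inr (@inj (Sum.inl j) (Sum.inr (Sum.inr k)) hj)
  have θψ : ∀ k, circPt (x.2.2 k) ^ m + 1 ≠ 0 := fun k hk => by
    obtain ⟨j, hj⟩ := hψ.superset (eq_neg_of_add_eq_zero_left hk)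
    exact Sum.inl_ne_inr (Sum.inr_injective (@inj (Sum.inr (Sum.inl j)) (Sum.inr (Sum.inr k)) hj))
  have hdeg := jacobiPoly_natDegree_le n (p - 1 / 2) (q - 1 / 2)
  rw [← Complex.ofReal_eq_zero]
  simp only [Complex.ofReal_sum, Complex.ofReal_add, Complex.ofReal_mul, ofReal_cot_half_sub,
    Fintype.sum_sum_type, charge, Sum.elim_inl, Sum.elim_inr, one_mul,
    mul_left_comm _ Complex.I, ← Finset.mul_sum, ← mul_add, angles]
  refine mul_eq_zero_of_right _ ?_
  rcases a with j | j | k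
  · simp only [Sum.elim_inl]
    rw [sum_add_div_sub_pow_roots_self one_ne_zero φi φr j,
      sum_add_div_sub_pow_roots ψi ψr (by rw [φr]; norm_num),
      sum_add_div_sub_circlePoly_roots hdeg θi θr (circPt_ne_zero _) (φθ j) (by simp [φr]), φr]
    simp
  · simp only [Sum.elim_inl, Sum.elim_inr]
    rw [sum_add_div_sub_pow_roots_self (neg_ne_zero.mpr one_ne_zero) ψi ψr j,
      sum_add_div_sub_pow_roots φi φr (by rw [ψr]; norm_num),
      sum_add_div_sub_circlePoly_roots hdeg θi θr (circPt_ne_zero _) (ψθ j) (by simp [ψr]), ψr]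
    simp
  -- Only here do nonzero forces occur: those of `φ` and `ψ` cancel the mutual force of the `θ`.
  · simp only [Sum.elim_inr]
    rw [sum_add_div_sub_pow_roots φi φr (θφ k),
      sum_add_div_sub_pow_roots ψi ψr (by simpa using θψ k),
      sum_add_div_sub_roots_jacobi hm hn hp θi θr k (circPt_ne_zero _) (θφ k) (θψ k)]
    simp only [sub_neg_eq_add, ← sub_eq_add_neg]
    ring

/-! ### Construction of the extremal configuration. -/

theorem range_eq_roots {N : ℕ} {z : Fin N → ℂ} {R : ℂ[X]} (hz : Function.Injective z) (hR : R ≠ 0)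
    (hdeg : R.natDegree ≤ N) (hroot : ∀ i, R.eval (z i) = 0) :
    Set.range z = {w : ℂ | R.eval w = 0} := by
  refine Set.Subset.antisymm (Set.range_subset_iff.mpr hroot) fun w hw => ?_
  have h := eq_C_mul_prod_X_sub_C hz (by simpa using hdeg) hroot
  have hw' : R.eval w = 0 := hw
  rw [h, eval_C_mul, eval_prod, mul_eq_zero, Finset.prod_eq_zero_iff] at hw'
  obtain ⟨i, -, hi⟩ := hw'.resolve_left (leadingCoeff_ne_zero.mpr hR)
  exact ⟨i, by simpa [sub_eq_zero, eq_comm] using hi⟩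

theorem circPt_pow (t : ℝ) (m : ℕ) : circPt t ^ m = circPt (m * t) := by
  rw [circPt, circPt, ← Complex.exp_nat_mul]
  congr 1
  push_cast
  ring

theorem circPt_add_two_pi_mul (t : ℝ) (j : ℕ) : circPt (2 * Real.pi * j + t) = circPt t := by
  rw [circPt, circPt, Complex.exp_eq_exp_iff_exists_int]
  exact ⟨j, by push_cast; ring⟩

theorem joukowski_circPt (t : ℝ) : circPt t / 2 + 1 / (2 * circPt t) = Real.cos t := by
  rw [Complex.ofReal_cos, Complex.cos, circPt, neg_mul, Complex.exp_neg]
  field_simp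

/-- The angles of one period of the extremal configuration, in `(0, 2π)` after rescaling: the `τ`'s
followed by their reflections in `π`. -/
noncomputable def foldedAngle (n : ℕ) (τ : ℕ → ℝ) (i : ℕ) : ℝ :=
  if i < n then τ i else 2 * Real.pi - τ (2 * n - 1 - i)

theorem foldedAngle_lt {n : ℕ} {τ : ℕ → ℝ} (hmono : ∀ i j, i < j → j < n → τ i < τ j)
    (hmem : ∀ i < n, τ i ∈ Set.Ioo 0 Real.pi) {i j : ℕ} (hij : i < j) (hj : j < 2 * n) :
    foldedAngle n τ i < foldedAngle n τ j := by
  unfold foldedAngle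
  split_ifs with h1 h2 h2
  · exact hmono _ _ hij h2
  · linarith [(hmem i h1).2, (hmem (2 * n - 1 - j) (by omega)).2]
  · omega
  · linarith [hmono (2 * n - 1 - j) (2 * n - 1 - i) (by omega) (by omega)]

theorem foldedAngle_of_lt {n : ℕ} {τ : ℕ → ℝ} (hmem : ∀ i < n, τ i ∈ Set.Ioo 0 Real.pi) {i : ℕ}
    (hi : i < n) : foldedAngle n τ i ∈ Set.Ioo 0 Real.pi := by
  rw [foldedAngle, if_pos hi]; exact hmem i hi

theorem foldedAngle_of_ge {n : ℕ} {τ : ℕ → ℝ} (hmem : ∀ i < n, τ i ∈ Set.Ioo 0 Real.pi) {i : ℕ}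
    (hi : n ≤ i) (hi' : i < 2 * n) : foldedAngle n τ i ∈ Set.Ioo Real.pi (2 * Real.pi) := by
  rw [foldedAngle, if_neg (by omega)]
  have := hmem (2 * n - 1 - i) (by omega)
  exact ⟨by linarith [this.2], by linarith [this.1]⟩

/-- The extremal configuration built from the angles `τ` in `(0, π)`. -/
noncomputable def periodicConfig (m n : ℕ) (τ : ℕ → ℝ) : Config m n :=
  (fun j => 2 * Real.pi * (j : ℕ) / m, fun j => (2 * Real.pi * (j : ℕ) + Real.pi) / m,
    fun k => (2 * Real.pi * ((k : ℕ) / (2 * n) : ℕ) + foldedAngle n τ ((k : ℕ) % (2 * n))) / m)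

theorem periodicConfig_mem {m n : ℕ} (hm : 1 ≤ m) (hn : 1 ≤ n) {τ : ℕ → ℝ}
    (hmono : ∀ i j, i < j → j < n → τ i < τ j) (hmem : ∀ i < n, τ i ∈ Set.Ioo 0 Real.pi) :
    periodicConfig m n τ ∈ configSpace m n := by
  have hm' : (0 : ℝ) < m := by exact_mod_cast hm
  have hpi := Real.pi_pos
  have hrange : ∀ i < 2 * n, foldedAngle n τ i ∈ Set.Ioo 0 (2 * Real.pi) := by
    intro i hi
    rcases Nat.lt_or_ge i n with h | h
    · have := foldedAngle_of_lt hmem h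
      exact ⟨this.1, by linarith [this.2]⟩
    · have := foldedAngle_of_ge hmem h hi
      exact ⟨by linarith [this.1], this.2⟩
  -- Quotient and remainder by `2n` are the period and the position within it.
  have hdm : ∀ j i k : ℕ, k = 2 * n * j + i → i < 2 * n → k / (2 * n) = j ∧ k % (2 * n) = i := by
    intro j i k hk hi
    subst hk
    exact ⟨by rw [Nat.mul_add_div (by omega), Nat.div_eq_of_lt hi, add_zero],
      by rw [Nat.mul_add_mod, Nat.mod_eq_of_lt hi]⟩
  refine ⟨fun j hj => by simp [periodicConfig, hj], fun k l hkl => ?_, fun j k h1 h2 => ?_,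
    fun j k h1 h2 => ?_⟩
  · simp only [periodicConfig]
    refine div_lt_div_of_pos_right ?_ hm'
    have hkl' : (k : ℕ) < l := hkl
    have d1 := Nat.div_le_div_right (c := 2 * n) hkl'.le
    have r1 := hrange _ (Nat.mod_lt (k : ℕ) (by omega : 2 * n > 0))
    have r2 := hrange _ (Nat.mod_lt (l : ℕ) (by omega : 2 * n > 0))
    rcases d1.eq_or_lt with e | e
    · rw [e]
      have := foldedAngle_lt hmono hmem (i := (k : ℕ) % (2 * n)) (j := (l : ℕ) % (2 * n)) (by
        have a1 := Nat.div_add_mod (k : ℕ) (2 * n)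
        have a2 := Nat.div_add_mod (l : ℕ) (2 * n)
        rw [e] at a1
        omega) (Nat.mod_lt _ (by omega))
      linarith
    · have : (((k : ℕ) / (2 * n) : ℕ) : ℝ) + 1 ≤ ((l : ℕ) / (2 * n) : ℕ) := by exact_mod_cast e
      nlinarith [r1.2, r2.1]
  · have e1 : 2 * (j : ℕ) * n = 2 * n * j := by ring
    have e2 : (2 * (j : ℕ) + 1) * n = 2 * n * j + n := by ring
    obtain ⟨d, r⟩ := hdm j (k - 2 * n * j) k (by omega) (by omega)
    have := foldedAngle_of_lt hmem (i := (k : ℕ) - 2 * n * j) (by omega)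
    simp only [periodicConfig, d, r]
    exact ⟨div_lt_div_of_pos_right (by linarith [this.1]) hm',
      div_lt_div_of_pos_right (by linarith [this.2]) hm'⟩
  · have e1 : (2 * (j : ℕ) + 2) * n = 2 * n * j + 2 * n := by ring
    have e2 : (2 * (j : ℕ) + 1) * n = 2 * n * j + n := by ring
    obtain ⟨d, r⟩ := hdm j (k - 2 * n * j) k (by omega) (by omega)
    have := foldedAngle_of_ge hmem (i := (k : ℕ) - 2 * n * j) (by omega) (by omega)
    have hnext : nextAngle (periodicConfig m n τ).1 j = 2 * Real.pi * ((j : ℕ) + 1) / m := by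
      unfold nextAngle
      split_ifs with h
      · simp [periodicConfig]
      · have : m = (j : ℕ) + 1 := by omega
        have h3 : (m : ℝ) = (j : ℕ) + 1 := by exact_mod_cast this
        rw [← h3]
        field_simp
    rw [hnext]
    simp only [periodicConfig, d, r]
    exact ⟨div_lt_div_of_pos_right (by linarith [this.1]) hm',
      div_lt_div_of_pos_right (by linarith [this.2]) hm'⟩

/-- Taking `m`-th powers removes the period, and reflection in `π` preserves the cosine, so every
`θ` gives a zero. Distinctness and the degree bound make these all the zeros. -/
theorem periodicConfig_isJacobiConfig {m n : ℕ} (hm : 1 ≤ m) (hn : 1 ≤ n) {p q : ℝ} (hp : 0 < p)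
    {τ : ℕ → ℝ} (hmono : ∀ i j, i < j → j < n → τ i < τ j)
    (hmem : ∀ i < n, τ i ∈ Set.Ioo 0 Real.pi)
    (hroot : ∀ i < n, (jacobiPoly n (p - 1 / 2) (q - 1 / 2)).eval (Real.cos (τ i)) = 0) :
    IsJacobiConfig m n p q (periodicConfig m n τ) := by
  have inj := circPt_angles_injective hn (periodicConfig_mem hm hn hmono hmem)
  have φi : Function.Injective fun j => circPt ((periodicConfig m n τ).1 j) :=
    inj.comp Sum.inl_injective
  have ψi : Function.Injective fun j => circPt ((periodicConfig m n τ).2.1 j) :=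
    inj.comp (Sum.inr_injective.comp Sum.inl_injective)
  have θi : Function.Injective fun k => circPt ((periodicConfig m n τ).2.2 k) :=
    inj.comp (Sum.inr_injective.comp Sum.inr_injective)
  have hm' : (m : ℝ) ≠ 0 := by exact_mod_cast (by omega : m ≠ 0)
  refine ⟨?_, ?_, ?_⟩
  · rw [range_eq_roots φi (X_pow_sub_C_ne_zero hm 1) (natDegree_X_pow_sub_C).le]
    · simp [sub_eq_zero]
    · intro j
      have h := circPt_add_two_pi_mul 0 j
      simp only [periodicConfig, eval_sub, eval_pow, eval_X, eval_C, circPt_pow,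
        mul_div_cancel₀ _ hm']
      rw [add_zero] at h
      rw [h]
      simp [circPt]
  · rw [range_eq_roots ψi (X_pow_sub_C_ne_zero hm (-1)) (natDegree_X_pow_sub_C).le]
    · simp [add_eq_zero_iff_eq_neg]
    · intro j
      simp only [periodicConfig, eval_sub, eval_pow, eval_X, eval_C, circPt_pow,
        mul_div_cancel₀ _ hm', circPt_add_two_pi_mul]
      simp [circPt]
  · refine range_eq_roots θi (circlePoly_jacobiPoly_ne_zero m n (by linarith))
      (circlePoly_natDegree_le _ _ _) fun k => ?_
    rw [circlePoly_eval _ _ _ (jacobiPoly_natDegree_le _ _ _) _ (circPt_ne_zero _)]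
    refine mul_eq_zero_of_right _ ?_
    simp only [periodicConfig, circPt_pow, mul_div_cancel₀ _ hm', circPt_add_two_pi_mul,
      joukowski_circPt]
    have hmod := Nat.mod_lt (k : ℕ) (by omega : 2 * n > 0)
    obtain ⟨i, hi, hcos⟩ : ∃ i < n,
        Real.cos (foldedAngle n τ ((k : ℕ) % (2 * n))) = Real.cos (τ i) := by
      unfold foldedAngle
      split_ifs with h
      · exact ⟨_, h, rfl⟩
      · exact ⟨2 * n - 1 - (k : ℕ) % (2 * n), by omega, by rw [Real.cos_two_pi_sub]⟩
    rw [hcos, show ((Real.cos (τ i) : ℝ) : ℂ) = algebraMap ℝ ℂ (Real.cos (τ i)) from rfl,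
      aeval_algebraMap_apply, coe_aeval_eq_eval, hroot i hi, map_zero]

theorem exists_isJacobiConfig {m n : ℕ} (hm : 1 ≤ m) (hn : 1 ≤ n) {p q : ℝ} (hp : 0 < p)
    (hq : 0 < q) : ∃ x ∈ configSpace m n, IsJacobiConfig m n p q x := by
  obtain ⟨z, hz, hz0⟩ := jacobiPoly_exists_roots n (p - 1 / 2) (q - 1 / 2) (by linarith)
    (by linarith)
  -- The zeros are reversed because `arccos` decreases; the value `0` beyond `n` is never used.
  let τ : ℕ → ℝ := fun i => if h : i < n then Real.arccos (z (Fin.rev ⟨i, h⟩)) else 0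
  have hτ : ∀ i (h : i < n), τ i = Real.arccos (z (Fin.rev ⟨i, h⟩)) := fun i h => dif_pos h
  have hmem : ∀ i < n, τ i ∈ Set.Ioo 0 Real.pi := fun i h => by
    rw [hτ i h]
    exact ⟨Real.arccos_pos.mpr (hz0 _).1.2, (Real.arccos_lt_pi).mpr (hz0 _).1.1⟩
  have hmono : ∀ i j, i < j → j < n → τ i < τ j := fun i j hij hj => by
    rw [hτ i (hij.trans hj), hτ j hj]
    exact Real.strictAntiOn_arccos (Set.Ioo_subset_Icc_self (hz0 _).1)
      (Set.Ioo_subset_Icc_self (hz0 _).1) (hz (Fin.rev_lt_rev.mpr hij))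
  refine ⟨_, periodicConfig_mem hm hn hmono hmem,
    periodicConfig_isJacobiConfig hm hn hp hmono hmem fun i hi => ?_⟩
  rw [hτ i hi, Real.cos_arccos (hz0 _).1.1.le (hz0 _).1.2.le]
  exact (hz0 _).2

theorem theorem1p1 (m n : ℕ) (hm : 1 ≤ m) (hn : 1 ≤ n) (p q : ℝ) (hp : 0 < p) (hq : 0 < q) :
    Convex ℝ (configSpace m n) ∧
    (∃! x : Config m n, x ∈ configSpace m n ∧
      IsMaxOn (hamiltonian m n p q) (configSpace m n) x) ∧
    (∀ φ ψ : Fin m → ℝ, ∀ θ : Fin (2 * m * n) → ℝ, (φ, ψ, θ) ∈ configSpace m n →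
      (IsMaxOn (hamiltonian m n p q) (configSpace m n) (φ, ψ, θ) ↔
        Set.range (fun j => circPt (φ j)) = {z : ℂ | z ^ m = 1} ∧
        Set.range (fun j => circPt (ψ j)) = {z : ℂ | z ^ m = -1} ∧
        Set.range (fun k => circPt (θ k)) =
          {z : ℂ | (circlePoly m n (jacobiPoly n (p - 1 / 2) (q - 1 / 2))).eval z = 0})) := by
  have hlt : ∀ x ∈ configSpace m n, IsJacobiConfig m n p q x → ∀ y ∈ configSpace m n, x ≠ y →
      hamiltonian m n p q y < hamiltonian m n p q x := fun x hx hJ y hy hne =>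
    hamiltonian_lt_of_critical hm hn hp hq hx hy hne (hJ.critical hm hn hp hx)
  have hmax : ∀ x ∈ configSpace m n, IsJacobiConfig m n p q x →
      IsMaxOn (hamiltonian m n p q) (configSpace m n) x := fun x hx hJ y hy => by
    by_cases hne : x = y
    · exact hne ▸ le_refl (hamiltonian m n p q x)
    · exact (hlt x hx hJ y hy hne).le
  obtain ⟨x₀, hx₀, hJ₀⟩ := exists_isJacobiConfig hm hn hp hq
  have huniq : ∀ y ∈ configSpace m n, IsMaxOn (hamiltonian m n p q) (configSpace m n) y →
      y = x₀ := fun y hy hmy => by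
    by_contra hne
    exact absurd (hmy hx₀) (not_le.mpr (hlt x₀ hx₀ hJ₀ y hy (Ne.symm hne)))
  refine ⟨convex_configSpace m n, ⟨x₀, ⟨hx₀, hmax x₀ hx₀ hJ₀⟩, fun y hy => huniq y hy.1 hy.2⟩,
    fun φ ψ θ hx => ⟨fun h => ?_, fun h => hmax _ hx h⟩⟩
  -- A maximizer is `x₀` itself, so it inherits the description; no critical equation at it is
  -- needed.
  rw [← huniq _ hx h] at hJ₀
  exact hJ₀
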